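/- **Setting.** Let $F_n$, $n\ge 1$, be probability distribution functions with $F_n(0)=0$ and $F_n(1)=1$, and let $\alpha_n>0$ be such that $0<\liminf_n\alpha_n\le\limsup_n\alpha_n<\infty$ and $$\lim_{t\to0^+}\sup_{n\ge1}\left|\frac{F_n(t)}{t}-\alpha_n\right|=0,\qquad \lim_{t\to0^+}\sup_{n\ge1}\int_0^t\frac1u\left|\frac{F_n(u)}{u}-\alpha_n\right|du=0.$$ Let $(a_{k,n})_{1\le k\le n}$ be positive numbers, $(\rho_n)$ real numbers with $\rho_n\log n\to+\infty$, and $\ell\in\mathbb R$, such that $$\limsup_{n\to\infty}\frac{\sum_{k=1}^n\alpha_ka_{k,n}|\log(\alpha_ka_{k,n})|}{\rho_n\log n}<\infty,\qquad \lim_{n\to\infty}\frac{\sum_{k=1}^n\alpha_ka_{k,n}\log(\alpha_ka_{k,n})}{\rho_n\log n}=-\ell,$$ the sequence $n\mapsto\sum_{k=1}^n\alpha_ka_{k,n}$ is bounded, and $\sup_n\max_{k\le n}a_{k,n}<\infty$. Let $(D_n)_{n\ge1}$ be a Sylvester sequence driven by $(F_n)$, that is: integer-valued random variables on a probability space, with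 $D_1\ge2$ almost surely, such that for all $n\ge1$ and all integers $d_1\ge2$, $d_j\ge d_{j-1}(d_{j-1}-1)+1$ ($2\le j\le n$) with $P(D_1=d_1,\dots,D_n=d_n)>0$, and every integer $d\ge2$, $$P(D_{n+1}=d\mid D_n=d_n,\dots,D_1=d_1)=F_n\!\left(\frac{d_n(d_n-1)}{d-1}\right)-F_n\!\left(\frac{d_n(d_n-1)}{d}\right).$$ (Equivalently, $\Theta_n=D_n-1$ follows the Oppenheim scheme with $Q_n=0$, $\varphi_n(h)=h(h+1)$, and its Oppenheim expansion is $R_n=\frac{D_{n+1}-1}{D_n(D_n-1)}$.) **Statement.** Under these assumptions $$\frac1{\rho_n\log n}\sum_{k=1}^na_{k,n}\frac{D_{k+1}}{D_k^2}\;\longrightarrow\;\ell\qquad\text{in probability as }n\to\infty.$$ Moreover, if the conditions on $a_{k,n}$, $\rho_n$, $\ell$ hold with $\alpha_k=1$ for all $k$, then the same convergence holds on $[0,1]$ with Lebesgue measure for the classical Sylvester digits $D_n=D_n(x)$, which are defined by $x_1=x$, $D_n=\lfloor 1/x_n\rfloor+1$, $x_{n+1}=x_n-1/D_n$, so that $x=\sum_{n\ge1}1/D_n$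 for $x\in(0,1]$. -/

import Mathlib

open MeasureTheory ProbabilityTheory Filter Topology

/-- Regularity of a family of distribution functions `F n`, `n ≥ 1`, at the origin, with slopes
`α n`:
`α` is positive and `0 < liminf α ≤ limsup α < ∞`;
`sup_n |F n t / t - α n| → 0` as `t → 0+`;
`sup_n ∫_0^t (1/u) |F n u / u - α n| du → 0` as `t → 0+`. -/
structure RegularAtZero (F : ℕ → ℝ → ℝ) (α : ℕ → ℝ) : Prop where
  pos : ∀ n, 1 ≤ n → 0 < α n
  liminf_pos : 0 < liminf (fun n => (α n : EReal)) atTop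
  limsup_lt_top : limsup (fun n => (α n : EReal)) atTop < ⊤
  slope : Tendsto
    (fun t : ℝ => ⨆ n : ℕ, ⨆ _ : 1 ≤ n, ENNReal.ofReal |F n t / t - α n|) (𝓝[>] 0) (𝓝 0)
  uniformly_integrable : Tendsto
    (fun t : ℝ => ⨆ n : ℕ, ⨆ _ : 1 ≤ n,
      ∫⁻ u in Set.Ioo 0 t, ENNReal.ofReal (1 / u * |F n u / u - α n|)) (𝓝[>] 0) (𝓝 0)

/-- The conditions on the weights `a k n`, `1 ≤ k ≤ n`, and the normalisation `ρ`, relative to the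
slopes `α`; the number `ℓ` is the constant that they determine. -/
structure WeightConditions (α : ℕ → ℝ) (a : ℕ → ℕ → ℝ) (ρ : ℕ → ℝ) (ℓ : ℝ) : Prop where
  pos : ∀ n k, 1 ≤ k → k ≤ n → 0 < a k n
  norm_tendsto : Tendsto (fun n : ℕ => ρ n * Real.log n) atTop atTop
  limsup_abs_lt_top :
    limsup (fun n : ℕ =>
      (((∑ k ∈ Finset.Icc 1 n, α k * a k n * |Real.log (α k * a k n)|) /
        (ρ n * Real.log n) : ℝ) : EReal)) atTop < ⊤
  tendsto_neg : Tendsto (fun n : ℕ =>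
      (∑ k ∈ Finset.Icc 1 n, α k * a k n * Real.log (α k * a k n)) /
        (ρ n * Real.log n)) atTop (𝓝 (-ℓ))
  bounded_sum : ∃ S : ℝ, ∀ n : ℕ, ∑ k ∈ Finset.Icc 1 n, α k * a k n ≤ S
  bounded_weights : ∃ M : ℝ, ∀ n k : ℕ, 1 ≤ k → k ≤ n → a k n ≤ M

/-- `δ(h, k, q) = φ(h) (1 + q) / (k + φ(h) q)`, as a function of `y = φ(h)`, `k` and `q`. -/
noncomputable def oppenheimDelta (y k q : ℝ) : ℝ := y * (1 + q) / (k + y * q)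

/-- The Oppenheim scheme: `Θ 1, Θ 2, …` are random positive integers such that, for `h 1 ≥ 1`,
`h j ≥ φ (j-1) (h (j-1))` for `2 ≤ j ≤ n`, and every positive integer `h (n+1)`, the conditional
probability of `Θ (n+1) = h (n+1)` given `Θ n = h n, …, Θ 1 = h 1` (an event of positive
probability) is `F n (δ(h n, h (n+1), q)) - F n (δ(h n, h (n+1) + 1, q))`, where `q` is the value of
`q n` at `(h 1, …, h n)`. -/
structure IsOppenheimScheme {Ω : Type*} [MeasurableSpace Ω] (P : Measure Ω)
    (F : ℕ → ℝ → ℝ) (φ : ℕ → ℕ → ℝ) (q : (n : ℕ) → (Finset.Icc 1 n → ℕ) → ℝ)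
    (Θ : ℕ → Ω → ℕ) : Prop where
  measurable : ∀ n, 1 ≤ n → Measurable (Θ n)
  first_pos : ∀ᵐ ω ∂P, 1 ≤ Θ 1 ω
  phi_pos : ∀ n h, 1 ≤ n → 1 ≤ h → 0 < φ n h
  q_nonneg : ∀ n h, 0 ≤ q n h
  cond_law : ∀ (n : ℕ) (h : ℕ → ℕ), 1 ≤ n → 1 ≤ h 1 →
    (∀ j ∈ Finset.Icc 2 n, φ (j - 1) (h (j - 1)) ≤ h j) → 1 ≤ h (n + 1) →
    P {ω | ∀ j ∈ Finset.Icc 1 n, Θ j ω = h j} ≠ 0 →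
    (P[|{ω | ∀ j ∈ Finset.Icc 1 n, Θ j ω = h j}]).real {ω | Θ (n + 1) ω = h (n + 1)} =
      F n (oppenheimDelta (φ n (h n)) (h (n + 1)) (q n fun j => h j)) -
      F n (oppenheimDelta (φ n (h n)) (h (n + 1) + 1) (q n fun j => h j))

/-- `D 1, D 2, …` is a Sylvester sequence driven by the distribution functions `F 1, F 2, …`: the
shifted digits `Θ n = D n - 1` follow the Oppenheim scheme with `Q = 0` and with `φ n` equal to
`d (d - 1)` in terms of the digit `d`, that is, to `h (h + 1)` in terms of `h = d - 1`. The
associated Oppenheim expansion is `R n = (D (n+1) - 1) / (D n (D n - 1))`. -/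
structure IsSylvesterSequence {Ω : Type*} [MeasurableSpace Ω] (P : Measure Ω)
    (F : ℕ → ℝ → ℝ) (D : ℕ → Ω → ℕ) : Prop where
  measurable : ∀ n, 1 ≤ n → Measurable (D n)
  scheme : IsOppenheimScheme P F (fun _ h => (h : ℝ) * (h + 1)) (fun _ _ => 0)
    (fun n ω => D n ω - 1)

/-- The remainders of the Sylvester series algorithm, indexed from `0`: start with `x`, and at each
step subtract `1 / d` from the remainder `r`, where `d = ⌊1 / r⌋ + 1` is the digit, so that
`1 / d < r ≤ 1 / (d - 1)`. -/
noncomputable def sylvesterRemainder (x : ℝ) : ℕ → ℝ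
  | 0 => x
  | n + 1 => sylvesterRemainder x n - 1 / ((⌊1 / sylvesterRemainder x n⌋₊ : ℝ) + 1)

/-- The digits `D 1, D 2, …` of the Sylvester series `x = ∑ 1 / D n` of `x ∈ (0, 1]`
(the value at index `0` is not used). -/
noncomputable def sylvesterDigit (n : ℕ) (x : ℝ) : ℕ :=
  ⌊1 / sylvesterRemainder x (n - 1)⌋₊ + 1

/-! Put Θ = D - 1, N = ρ_n log n and y = Θ_k(Θ_k + 1). Telescoping the conditional law gives
P(Θ_{k+1} ≥ m | past) = F_k(y/m) (`cond_tail`), so each summand has a tail of order 1/t and need not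
have a mean. The proof is a truncated weak law of large numbers.

Truncate Θ_{k+1} at (N/a)y. By the linear bound on F_k the truncation matters with probability at
most Ca/N (`measureReal_exceed_le`), and the weights have bounded sum. The truncated terms, centred
at their conditional means, are orthogonal with second moments at most a² + 3CaN; their sum has
variance O(N), and Chebyshev at scale N leaves O(1/N) (`measureReal_sum_centredTerm_ge_le`).

The conditional means remain. Each is a harmonic sum equal to aα log(N/a) up to small errors
(`abs_truncatedMean_sub_le`). With b = αa this is -b log b + b(log N + log α). The second part sums
to O(log N) = o(N), and the first, divided by N, tends to ℓ. The digits grow at least geometrically,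
so what still depends on the history is negligible, uniformly over histories
(`eventually_sum_truncatedMean`).

For Lebesgue measure, prescribing the first n digits confines x to an explicit interval; ratios of
lengths show that the classical digits are the case F_n(t) = min(t, 1) on t ≥ 0. -/

/-! ### Uniform bounds on the distribution functions. -/

theorem RegularAtZero.exists_slope_bounds {F : ℕ → ℝ → ℝ} {α : ℕ → ℝ} (h : RegularAtZero F α) :
    ∃ c C : ℝ, 0 < c ∧ ∀ n, 1 ≤ n → c ≤ α n ∧ α n ≤ C := by
  obtain ⟨C, hC⟩ : ∃ C, ∀ n, α n ≤ C := by
    obtain ⟨B, hB, -⟩ := EReal.lt_iff_exists_real_btwn.1 h.limsup_lt_top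
    have hev : ∀ᶠ n in atTop, α n ≤ B :=
      (eventually_lt_of_limsup_lt hB).mono fun n hn => (EReal.coe_lt_coe_iff.1 hn).le
    obtain ⟨C, hC⟩ := (Filter.isBoundedUnder_of_eventually_le hev).bddAbove_range
    exact ⟨C, fun n => hC ⟨n, rfl⟩⟩
  obtain ⟨c, hc0, hc⟩ : ∃ c, 0 < c ∧ ∀ n, 1 ≤ n → c ≤ α n := by
    obtain ⟨b, hb0, hb⟩ := EReal.lt_iff_exists_real_btwn.1 h.liminf_pos
    have hb0 : 0 < b := by exact_mod_cast hb0
    -- Inverses turn the eventual lower bound into an upper bound, which extends to all indices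
    -- because a sequence bounded eventually has bounded range.
    have hev : ∀ᶠ n in atTop, (α n)⁻¹ ≤ b⁻¹ :=
      (eventually_lt_of_lt_liminf hb).mono fun n hn =>
        inv_anti₀ hb0 (EReal.coe_lt_coe_iff.1 hn).le
    obtain ⟨C', hC'⟩ := (Filter.isBoundedUnder_of_eventually_le hev).bddAbove_range
    have hC' : ∀ n, (α n)⁻¹ ≤ C' := fun n => hC' ⟨n, rfl⟩
    have hC0 : 0 < C' := (inv_pos.2 (h.pos 1 le_rfl)).trans_le (hC' 1)
    exact ⟨C'⁻¹, inv_pos.2 hC0, fun n hn => inv_le_of_inv_le₀ (h.pos n hn) (hC' n)⟩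
  exact ⟨c, C, hc0, fun n hn => ⟨hc n hn, hC n⟩⟩

theorem RegularAtZero.exists_slope_close {F : ℕ → ℝ → ℝ} {α : ℕ → ℝ} (h : RegularAtZero F α)
    {ε : ℝ} (hε : 0 < ε) :
    ∃ δ : ℝ, 0 < δ ∧ ∀ n, 1 ≤ n → ∀ u, 0 < u → u < δ → |F n u - α n * u| ≤ ε * u := by
  have := ENNReal.tendsto_nhds_zero.1 h.slope (ENNReal.ofReal ε) (by simpa using hε)
  obtain ⟨δ, hδ, hsub⟩ := mem_nhdsGT_iff_exists_Ioo_subset.1 this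
  refine ⟨δ, hδ, fun n hn u hu huδ => ?_⟩
  have h1 : (⨆ n : ℕ, ⨆ _ : 1 ≤ n, ENNReal.ofReal |F n u / u - α n|) ≤ ENNReal.ofReal ε :=
    hsub ⟨hu, huδ⟩
  have h2 : ENNReal.ofReal |F n u / u - α n| ≤ ENNReal.ofReal ε :=
    (le_iSup₂ (f := fun (n : ℕ) (_ : 1 ≤ n) => ENNReal.ofReal |F n u / u - α n|) n hn).trans h1
  have h3 := (ENNReal.ofReal_le_ofReal_iff hε.le).1 h2
  have h4 : F n u - α n * u = (F n u / u - α n) * u := by field_simp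
  rw [h4, abs_mul, abs_of_pos hu]
  gcongr

/-- Near 0 the slope condition applies; for u ≥ δ, F ≤ 1 ≤ u/δ. -/
theorem RegularAtZero.exists_linear_bound {F : ℕ → ℝ → ℝ} {α : ℕ → ℝ} (h : RegularAtZero F α)
    (h1 : ∀ n, 1 ≤ n → ∀ u, F n u ≤ 1) :
    ∃ C : ℝ, 0 < C ∧ ∀ n, 1 ≤ n → ∀ u, 0 < u → F n u ≤ C * u := by
  obtain ⟨c, C, hc, hα⟩ := h.exists_slope_bounds
  obtain ⟨δ, hδ, hF⟩ := h.exists_slope_close one_pos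
  have hC : 0 < C := hc.trans_le ((hα 1 le_rfl).1.trans (hα 1 le_rfl).2)
  refine ⟨C + 1 + δ⁻¹, by positivity, fun n hn u hu => ?_⟩
  rcases lt_or_ge u δ with hlt | hge
  · have := (abs_le.1 (hF n hn u hu hlt)).2
    have h2 : α n * u ≤ C * u := by gcongr; exact (hα n hn).2
    have : 0 ≤ δ⁻¹ * u := by positivity
    linarith
  · have h2 : 1 ≤ δ⁻¹ * u := by rw [inv_mul_eq_div, one_le_div hδ]; exact hge
    have h3 : 0 ≤ (C + 1) * u := by positivity
    linarith [h1 n hn u]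

/-- Away from 0 the error is at most linear, and u ≤ u²/δ there. In sums over u = y/m the linear
error costs only a small multiple of a logarithm, and the quadratic one converges. -/
theorem RegularAtZero.exists_quadratic_bound {F : ℕ → ℝ → ℝ} {α : ℕ → ℝ} (h : RegularAtZero F α)
    (h0 : ∀ n, 1 ≤ n → ∀ u, 0 ≤ F n u) (h1 : ∀ n, 1 ≤ n → ∀ u, F n u ≤ 1)
    {ε : ℝ} (hε : 0 < ε) :
    ∃ K : ℝ, 0 ≤ K ∧ ∀ n, 1 ≤ n → ∀ u, 0 < u → |F n u - α n * u| ≤ ε * u + K * u ^ 2 := by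
  obtain ⟨c, C, hc, hα⟩ := h.exists_slope_bounds
  obtain ⟨B, hB, hFB⟩ := h.exists_linear_bound h1
  obtain ⟨δ, hδ, hF⟩ := h.exists_slope_close hε
  have hC : 0 < C := hc.trans_le ((hα 1 le_rfl).1.trans (hα 1 le_rfl).2)
  refine ⟨(B + C) / δ, by positivity, fun n hn u hu => ?_⟩
  rcases lt_or_ge u δ with hlt | hge
  · have := hF n hn u hu hlt
    have : 0 ≤ (B + C) / δ * u ^ 2 := by positivity
    linarith
  · have h2 : (B + C) * u ≤ (B + C) / δ * u ^ 2 := by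
      have : 1 ≤ u / δ := (one_le_div hδ).2 hge
      calc (B + C) * u = (B + C) * u * 1 := by ring
        _ ≤ (B + C) * u * (u / δ) := by gcongr
        _ = _ := by ring
    have h3 : α n * u ≤ C * u := by gcongr; exact (hα n hn).2
    have h4 : 0 ≤ α n * u := mul_nonneg (h.pos n hn).le hu.le
    have h5 := hFB n hn u hu
    have h6 := h0 n hn u
    have h7 : 0 ≤ ε * u := by positivity
    have h8 : 0 ≤ B * u := by positivity
    rw [abs_le]
    constructor <;> linarith

/-! ### Harmonic sums and the truncated mean. -/

theorem log_succ_div_succ_le_sum_Ioc_inv {y L : ℕ} (hyL : y ≤ L) :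
    Real.log ((L + 1 : ℝ) / (y + 1)) ≤ ∑ m ∈ Finset.Ioc y L, (m : ℝ)⁻¹ := by
  induction L, hyL using Nat.le_induction with
  | base => rw [div_self (by positivity)]; simp
  | succ L hL ih =>
    rw [← Finset.insert_Ioc_right_eq_Ioc_add_one hL, Finset.sum_insert (by simp)]
    have h1 : ((L + 1 : ℕ) + 1 : ℝ) / (y + 1) = ((L + 1 : ℝ) / (y + 1)) * ((L + 2 : ℝ) / (L + 1)) := by
      push_cast; field_simp; ring
    rw [h1, Real.log_mul (by positivity) (by positivity), add_comm]
    gcongr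
    refine (Real.log_le_sub_one_of_pos (by positivity)).trans (le_of_eq ?_)
    push_cast; field_simp; ring

theorem sum_Ioc_inv_le_log_div {y L : ℕ} (hy : 1 ≤ y) (hyL : y ≤ L) :
    ∑ m ∈ Finset.Ioc y L, (m : ℝ)⁻¹ ≤ Real.log ((L : ℝ) / y) := by
  have hy0 : (0 : ℝ) < y := by exact_mod_cast hy
  induction L, hyL using Nat.le_induction with
  | base => rw [div_self (by positivity)]; simp
  | succ L hL ih =>
    have hL0 : (0 : ℝ) < L := by exact_mod_cast hy.trans hL
    rw [← Finset.insert_Ioc_right_eq_Ioc_add_one hL, Finset.sum_insert (by simp)]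
    have h1 : ((L + 1 : ℕ) : ℝ) / y = ((L : ℝ) / y) / ((L : ℝ) / (L + 1)) := by
      push_cast; field_simp
    rw [h1, Real.log_div (x := (L : ℝ) / y) (by positivity) (by positivity)]
    have := Real.log_le_sub_one_of_pos (x := (L : ℝ) / (L + 1)) (by positivity)
    have h2 : (L : ℝ) / (L + 1) - 1 = - ((L + 1 : ℕ) : ℝ)⁻¹ := by
      push_cast; field_simp; ring
    linarith

theorem abs_sum_Ioc_inv_sub_log_le {y : ℕ} (hy : 1 ≤ y) {x : ℝ} (hx : 1 ≤ x) :
    |∑ m ∈ Finset.Ioc y ⌊x * y⌋₊, (m : ℝ)⁻¹ - Real.log x| ≤ 1 := by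
  have hy0 : (1 : ℝ) ≤ y := by exact_mod_cast hy
  have hyL : y ≤ ⌊x * y⌋₊ := Nat.le_floor (by nlinarith)
  have hL0 : (0 : ℝ) < ⌊x * y⌋₊ := by exact_mod_cast hy.trans hyL
  have h1 := log_succ_div_succ_le_sum_Ioc_inv hyL
  have h2 := sum_Ioc_inv_le_log_div hy hyL
  have h3 : (⌊x * y⌋₊ : ℝ) ≤ x * y := Nat.floor_le (by positivity)
  have h4 : x * y < ⌊x * y⌋₊ + 1 := Nat.lt_floor_add_one _
  have h5 : Real.log ((⌊x * y⌋₊ : ℝ) / y) ≤ Real.log x :=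
    Real.log_le_log (by positivity) (by rw [div_le_iff₀ (by positivity)]; exact h3)
  -- Since y + 1 ≤ 2y, the lower bound loses a factor 2 inside the logarithm, and log 2 < 1.
  have h6 : Real.log (x / 2) ≤ Real.log ((⌊x * y⌋₊ + 1 : ℝ) / (y + 1)) := by
    refine Real.log_le_log (by positivity) ?_
    rw [le_div_iff₀ (by positivity)]
    nlinarith
  rw [Real.log_div (by positivity) (by norm_num)] at h6
  have := Real.log_two_lt_d9
  rw [abs_le]
  constructor <;> linarith

/-- If `V ≥ 0` is integer-valued with `P (V ≥ m) = f (y / m)`, the sum is the mean of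
`min V ⌊x y⌋`. -/
theorem abs_sum_tail_sub_log_le {f : ℝ → ℝ} {α ε K : ℝ} (hα : 0 ≤ α) (hε : 0 ≤ ε) (hK : 0 ≤ K)
    (hf1 : ∀ u, 1 ≤ u → f u = 1) (hf : ∀ u, 0 < u → |f u - α * u| ≤ ε * u + K * u ^ 2)
    {y : ℕ} (hy : 1 ≤ y) {x : ℝ} (hx : 1 ≤ x) :
    |(∑ m ∈ Finset.Icc 1 ⌊x * y⌋₊, f (y / m)) / y - α * Real.log x| ≤
      ε * Real.log x + (1 + α + ε + K) := by
  have hy0 : (1 : ℝ) ≤ y := by exact_mod_cast hy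
  have hyL : y ≤ ⌊x * y⌋₊ := Nat.le_floor (by nlinarith)
  set L := ⌊x * y⌋₊
  have hH := abs_le.1 (abs_sum_Ioc_inv_sub_log_le hy hx)
  set H := ∑ m ∈ Finset.Ioc y L, (m : ℝ)⁻¹
  -- For m ≤ y the tail probability is 1; only m > y produces the logarithm.
  have hsplit : ∑ m ∈ Finset.Icc 1 L, f (y / m) = y + ∑ m ∈ Finset.Ioc y L, f (y / m) := by
    have h1 : ∑ m ∈ Finset.Ioc 0 y, f (y / m) = y := by
      rw [Finset.sum_congr rfl (g := fun _ => (1 : ℝ))]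
      · simp
      · intro m hm
        rw [Finset.mem_Ioc] at hm
        refine hf1 _ ?_
        rw [one_le_div (by exact_mod_cast hm.1)]
        exact_mod_cast hm.2
    have h2 := Finset.sum_Ioc_consecutive (fun m : ℕ => f (y / m)) (Nat.zero_le y) hyL
    rw [h1] at h2
    exact h2.symm
  have hsq : ∑ m ∈ Finset.Ioc y L, ((m : ℝ) ^ 2)⁻¹ ≤ (y : ℝ)⁻¹ := by
    have := sum_Ioc_inv_sq_le_sub (α := ℝ) (k := y) (n := L) (by omega) hyL
    have : (0 : ℝ) ≤ (L : ℝ)⁻¹ := by positivity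
    linarith
  have hmain : |∑ m ∈ Finset.Ioc y L, f (y / m) - α * y * H| ≤ ε * y * H + K * y := by
    calc |∑ m ∈ Finset.Ioc y L, f (y / m) - α * y * H|
        = |∑ m ∈ Finset.Ioc y L, (f (y / m) - α * (y / m))| := by
          rw [Finset.sum_sub_distrib, Finset.mul_sum]
          simp only [div_eq_mul_inv, mul_assoc]
      _ ≤ ∑ m ∈ Finset.Ioc y L, |f (y / m) - α * (y / m)| := Finset.abs_sum_le_sum_abs _ _
      _ ≤ ∑ m ∈ Finset.Ioc y L, (ε * (y / m) + K * (y / m : ℝ) ^ 2) := by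
          refine Finset.sum_le_sum fun m hm => hf _ ?_
          rw [Finset.mem_Ioc] at hm
          have : (0 : ℝ) < m := by exact_mod_cast (by omega : 0 < m)
          positivity
      _ = ε * y * H + K * y ^ 2 * ∑ m ∈ Finset.Ioc y L, ((m : ℝ) ^ 2)⁻¹ := by
          rw [Finset.sum_add_distrib, Finset.mul_sum, Finset.mul_sum]
          congr 1 <;> refine Finset.sum_congr rfl fun m _ => ?_
          · rw [div_eq_mul_inv]; ring
          · rw [div_pow, div_eq_mul_inv]; ring
      _ ≤ ε * y * H + K * y ^ 2 * (y : ℝ)⁻¹ := by gcongr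
      _ = ε * y * H + K * y := by field_simp
  have hdiv : |(∑ m ∈ Finset.Icc 1 L, f (y / m)) / y - (1 + α * H)| ≤ ε * H + K := by
    have : (∑ m ∈ Finset.Icc 1 L, f (y / m)) / y - (1 + α * H) =
        (∑ m ∈ Finset.Ioc y L, f (y / m) - α * y * H) / y := by
      rw [hsplit]; field_simp; ring
    rw [this, abs_div, abs_of_pos (by positivity : (0 : ℝ) < y), div_le_iff₀ (by positivity)]
    linarith
  have hαH1 : α * H ≤ α * (Real.log x + 1) := by gcongr; linarith
  have hαH2 : α * (Real.log x - 1) ≤ α * H := by gcongr; linarith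
  have hεH : ε * H ≤ ε * (Real.log x + 1) := by gcongr; linarith
  rw [abs_le] at hdiv ⊢
  constructor <;> nlinarith

/-- The mean of `a (min V ⌊(N / a) y⌋ + 1) / (h + 1) ^ 2` with `y = h (h + 1)`, when `V` is
integer-valued with `P (V ≥ m) = f (y / m)`. -/
noncomputable def truncatedMean (f : ℝ → ℝ) (a N : ℝ) (h : ℕ) : ℝ :=
  a / (h + 1) ^ 2 *
    (1 + ∑ m ∈ Finset.Icc 1 ⌊N / a * (h * (h + 1) : ℕ)⌋₊, f ((h * (h + 1) : ℕ) / m))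

/-- The normalisation is (h + 1)² rather than h(h + 1). Their quotient 1 - 1/(h + 1) causes the last
error term, which the growth of the digits makes summable. -/
theorem abs_truncatedMean_sub_le {f : ℝ → ℝ} {α ε K : ℝ} (hα : 0 ≤ α) (hε : 0 ≤ ε) (hK : 0 ≤ K)
    (hf1 : ∀ u, 1 ≤ u → f u = 1) (hf : ∀ u, 0 < u → |f u - α * u| ≤ ε * u + K * u ^ 2)
    {a N : ℝ} (ha : 0 < a) (haN : a ≤ N) {h : ℕ} (hh : 1 ≤ h) :
    |truncatedMean f a N h - a * (α * Real.log (N / a))| ≤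
      a * (ε * Real.log (N / a) + (2 + α + ε + K)) +
        a * ((α + ε) * Real.log (N / a) + (1 + α + ε + K)) / (h + 1) := by
  have hx : 1 ≤ N / a := (one_le_div ha).2 haN
  have hlog : 0 ≤ Real.log (N / a) := Real.log_nonneg hx
  have hy : 1 ≤ h * (h + 1) := by nlinarith
  have hs := abs_sum_tail_sub_log_le hα hε hK hf1 hf hy hx
  have hh0 : (0 : ℝ) < h := by exact_mod_cast hh
  set s := (∑ m ∈ Finset.Icc 1 ⌊N / a * (h * (h + 1) : ℕ)⌋₊, f ((h * (h + 1) : ℕ) / m)) /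
    ((h * (h + 1) : ℕ) : ℝ) with hsdef
  set l := Real.log (N / a)
  have hmean : truncatedMean f a N h - a * (α * l) =
      a * (s - α * l) + a / (h + 1) ^ 2 - a * s / (h + 1) := by
    rw [truncatedMean, hsdef]
    push_cast
    field_simp
    ring
  have hs2 : |s| ≤ (α + ε) * l + (1 + α + ε + K) := by
    have : |s| ≤ |s - α * l| + |α * l| := by
      simpa using abs_add_le (s - α * l) (α * l)
    rw [abs_of_nonneg (by positivity : 0 ≤ α * l)] at this
    linarith
  have h1 : |a * (s - α * l)| ≤ a * (ε * l + (1 + α + ε + K)) := by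
    rw [abs_mul, abs_of_pos ha]; gcongr
  have h2 : |a * s / (h + 1)| ≤ a * ((α + ε) * l + (1 + α + ε + K)) / (h + 1) := by
    rw [abs_div, abs_mul, abs_of_pos ha, abs_of_pos (by positivity : (0 : ℝ) < h + 1)]; gcongr
  have h3 : |a / ((h : ℝ) + 1) ^ 2| ≤ a := by
    rw [abs_of_pos (by positivity)]
    exact div_le_self ha.le (by nlinarith)
  rw [hmean]
  have h4 := abs_sub (a * (s - α * l) + a / ((h : ℝ) + 1) ^ 2) (a * s / (h + 1))
  have h5 := abs_add_le (a * (s - α * l)) (a / ((h : ℝ) + 1) ^ 2)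
  linarith

/-! ### Weights, and the limit of the summed conditional means. -/

theorem abs_log_le_of_mem_Icc {c C x : ℝ} (hc : 0 < c) (h1 : c ≤ x) (h2 : x ≤ C) :
    |Real.log x| ≤ |Real.log c| + |Real.log C| := by
  have h3 := Real.log_le_log hc h1
  have h4 := Real.log_le_log (hc.trans_le h1) h2
  rw [abs_le]
  constructor
  · linarith [neg_abs_le (Real.log c), abs_nonneg (Real.log C)]
  · linarith [le_abs_self (Real.log C), abs_nonneg (Real.log c)]

/-- Since -a log a ≤ 1 - a, small weights do no harm. -/
theorem mul_log_div_le {a M N : ℝ} (ha : 0 < a) (haM : a ≤ M) (hN : 1 ≤ N) :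
    a * Real.log (N / a) ≤ M * Real.log N + 1 := by
  rw [Real.log_div (by positivity) (by positivity)]
  have h1 : a * Real.log N ≤ M * Real.log N := by
    gcongr; exact Real.log_nonneg hN
  have h2 : a * (1 - a⁻¹) ≤ a * Real.log a := by
    gcongr; exact Real.one_sub_inv_le_log_of_pos ha
  have h3 : a * (1 - a⁻¹) = a - 1 := by field_simp
  linarith

theorem sum_Icc_inv_two_pow_le (n : ℕ) : ∑ k ∈ Finset.Icc 1 n, (1 : ℝ) / 2 ^ k ≤ 1 := by
  have : ∑ k ∈ Finset.Icc 1 n, (1 : ℝ) / 2 ^ k = 1 - 1 / 2 ^ n := by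
    induction n with
    | zero => simp
    | succ n ih =>
      rw [Finset.sum_Icc_succ_top (by omega), ih, pow_succ]; field_simp; ring
  rw [this]
  have : (0 : ℝ) ≤ 1 / 2 ^ n := by positivity
  linarith

theorem tendsto_log_affine_div {N : ℕ → ℝ} (hN : Tendsto N atTop atTop) (A B : ℝ) :
    Tendsto (fun n => (A * Real.log (N n) + B) / N n) atTop (𝓝 0) := by
  have h1 : Tendsto (fun x : ℝ => Real.log x / x) atTop (𝓝 0) :=
    Real.isLittleO_log_id_atTop.tendsto_div_nhds_zero
  have h2 : Tendsto (fun x : ℝ => x⁻¹) atTop (𝓝 0) := tendsto_inv_atTop_zero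
  have h3 : Tendsto (fun x : ℝ => A * (Real.log x / x) + B * x⁻¹) atTop (𝓝 0) := by
    simpa using (h1.const_mul A).add (h2.const_mul B)
  refine (h3.comp hN).congr fun n => ?_
  simp only [Function.comp]
  ring

theorem WeightConditions.exists_bounds {α : ℕ → ℝ} {a : ℕ → ℕ → ℝ} {ρ : ℕ → ℝ} {ℓ c : ℝ}
    (hw : WeightConditions α a ρ ℓ) (hc : 0 < c) (hα : ∀ k, 1 ≤ k → c ≤ α k) :
    ∃ S M : ℝ, 0 ≤ S ∧ 0 < M ∧ (∀ n k, 1 ≤ k → k ≤ n → a k n ≤ M) ∧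
      (∀ n, ∑ k ∈ Finset.Icc 1 n, α k * a k n ≤ S) ∧
      ∀ n, ∑ k ∈ Finset.Icc 1 n, a k n ≤ S / c := by
  obtain ⟨S, hS⟩ := hw.bounded_sum
  obtain ⟨M, hM⟩ := hw.bounded_weights
  refine ⟨S, M, by simpa using hS 0, (hw.pos 1 1 le_rfl le_rfl).trans_le (hM 1 1 le_rfl le_rfl),
    hM, hS, fun n => ?_⟩
  rw [le_div_iff₀ hc, Finset.sum_mul]
  refine le_trans (Finset.sum_le_sum fun k hk => ?_) (hS n)
  rw [Finset.mem_Icc] at hk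
  rw [mul_comm]
  gcongr
  · exact (hw.pos n k hk.1 hk.2).le
  · exact hα k hk.1

theorem WeightConditions.eventually_abs_log_le {α : ℕ → ℝ} {a : ℕ → ℕ → ℝ} {ρ : ℕ → ℝ} {ℓ : ℝ}
    (hw : WeightConditions α a ρ ℓ) :
    ∃ B : ℝ, 0 ≤ B ∧ ∀ᶠ n : ℕ in atTop,
      ∑ k ∈ Finset.Icc 1 n, α k * a k n * |Real.log (α k * a k n)| ≤ B * (ρ n * Real.log n) := by
  obtain ⟨B, hB, -⟩ := EReal.lt_iff_exists_real_btwn.1 hw.limsup_abs_lt_top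
  refine ⟨max B 0, le_max_right _ _, ?_⟩
  filter_upwards [eventually_lt_of_limsup_lt hB, hw.norm_tendsto.eventually_gt_atTop 0]
    with n hn hN
  have := (EReal.coe_lt_coe_iff.1 hn).le
  rw [div_le_iff₀ hN] at this
  refine this.trans ?_
  gcongr
  exact le_max_left _ _

/-- The quantifier over `h` is inside `∀ᶠ n`: the estimate is uniform over histories, so it can be
applied to the random digits pointwise. -/
theorem WeightConditions.eventually_sum_truncatedMean {α : ℕ → ℝ} {a : ℕ → ℕ → ℝ} {ρ : ℕ → ℝ}
    {ℓ c C : ℝ} (hw : WeightConditions α a ρ ℓ) (hc : 0 < c)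
    (hα : ∀ k, 1 ≤ k → c ≤ α k ∧ α k ≤ C) {f : ℕ → ℝ → ℝ}
    (hf1 : ∀ k, 1 ≤ k → ∀ u, 1 ≤ u → f k u = 1)
    (hf : ∀ ε : ℝ, 0 < ε → ∃ K : ℝ, 0 ≤ K ∧ ∀ k, 1 ≤ k → ∀ u, 0 < u →
      |f k u - α k * u| ≤ ε * u + K * u ^ 2) {η : ℝ} (hη : 0 < η) :
    ∀ᶠ n : ℕ in atTop, ∀ h : ℕ → ℕ, (∀ k ∈ Finset.Icc 1 n, 1 ≤ h k ∧ 2 ^ k ≤ 2 * h k) →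
      |1 / (ρ n * Real.log n) *
        ∑ k ∈ Finset.Icc 1 n, truncatedMean (f k) (a k n) (ρ n * Real.log n) (h k) - ℓ| < η := by
  obtain ⟨S, M, hS0, hM0, hM, hS, hSc⟩ := hw.exists_bounds hc fun k hk => (hα k hk).1
  obtain ⟨B, hB0, hB⟩ := hw.eventually_abs_log_le
  have hC0 : 0 < C := hc.trans_le ((hα 1 le_rfl).1.trans (hα 1 le_rfl).2)
  -- The error ε Σ b|log b| is only O(εN), not o(N), so ε must be fixed small before n grows; this
  -- is where the bound on Σ b|log b| enters.
  obtain ⟨ε, hε, hεη⟩ : ∃ ε : ℝ, 0 < ε ∧ ε / c * B ≤ η / 4 := by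
    refine ⟨η * c / (4 * (B + 1)), by positivity, ?_⟩
    have : η * c / (4 * (B + 1)) / c * B = η / 4 * (B / (B + 1)) := by field_simp
    rw [this]
    refine mul_le_of_le_one_right (by positivity) ((div_le_one (by positivity)).2 (by linarith))
  obtain ⟨K, hK0, hK⟩ := hf ε hε
  set Λ := |Real.log c| + |Real.log C|
  have hΛ0 : 0 ≤ Λ := by positivity
  set K1 := 2 + C + ε + K
  have hK10 : 0 ≤ K1 := by positivity
  -- `A` and `A'` collect the coefficient of log N and the constant in the rest of the summed error.
  set A := ε / c * S + 2 * (C + ε) * M + S with hA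
  set A' := ε / c * (S * Λ) + 2 * K1 * (S / c) + 2 * (C + ε) + S * Λ with hA'
  have hsmall := (tendsto_log_affine_div hw.norm_tendsto A A').eventually_lt_const
    (show (0 : ℝ) < η / 4 by positivity)
  have hlim := (Metric.tendsto_nhds.1 hw.tendsto_neg) (η / 4) (by positivity)
  filter_upwards [hB, hsmall, hlim, hw.norm_tendsto.eventually_ge_atTop (max 1 M)]
    with n hBn hsn hln hNn h hh
  set N := ρ n * Real.log n
  have hN1 : 1 ≤ N := (le_max_left _ _).trans hNn
  have hNM : M ≤ N := (le_max_right _ _).trans hNn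
  have hlN : 0 ≤ Real.log N := Real.log_nonneg hN1
  have hN0 : 0 < N := by linarith
  set b : ℕ → ℝ := fun k => α k * a k n with hb
  have hfacts : ∀ k ∈ Finset.Icc 1 n, 0 < a k n ∧ 0 < b k ∧ a k n ≤ M ∧ |Real.log (α k)| ≤ Λ ∧
      c ≤ α k ∧ α k ≤ C ∧
      Real.log (N / a k n) = Real.log N - Real.log (b k) + Real.log (α k) := by
    intro k hk
    rw [Finset.mem_Icc] at hk
    have ha := hw.pos n k hk.1 hk.2
    have hαk := hα k hk.1
    have hα0 := hc.trans_le hαk.1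
    refine ⟨ha, mul_pos hα0 ha, hM n k hk.1 hk.2, abs_log_le_of_mem_Icc hc hαk.1 hαk.2,
      hαk.1, hαk.2, ?_⟩
    rw [hb, Real.log_div hN0.ne' ha.ne', Real.log_mul hα0.ne' ha.ne']
    ring
  have hterm : ∀ k ∈ Finset.Icc 1 n,
      |truncatedMean (f k) (a k n) N (h k) - (- (b k * Real.log (b k)))| ≤
        (ε / c * Real.log N + ε / c * Λ + Real.log N + Λ) * b k +
          ε / c * (b k * |Real.log (b k)|) + 2 * K1 * a k n +
          (C + ε) * (M * Real.log N + 1) * (2 * (1 / 2 ^ k)) := by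
    intro k hk
    obtain ⟨ha, hbk, haM, hlα, hcα, hαC, hlog⟩ := hfacts k hk
    have hα0 := hc.trans_le hcα
    have hmean := abs_truncatedMean_sub_le hα0.le hε.le hK0 (hf1 k (Finset.mem_Icc.1 hk).1)
      (hK k (Finset.mem_Icc.1 hk).1) ha (haM.trans hNM) (hh k hk).1
    have hx0 : 0 ≤ Real.log (N / a k n) := Real.log_nonneg ((one_le_div ha).2 (haM.trans hNM))
    have hal := mul_log_div_le ha haM hN1
    have hab : a k n ≤ b k / c := by
      rw [le_div_iff₀ hc, mul_comm]; exact mul_le_mul_of_nonneg_right hcα ha.le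
    have hxle : Real.log (N / a k n) ≤ Real.log N + |Real.log (b k)| + Λ := by
      rw [hlog]; linarith [neg_abs_le (Real.log (b k)), le_abs_self (Real.log (α k))]
    have e1 : a k n * (ε * Real.log (N / a k n) + (2 + α k + ε + K)) ≤
        ε / c * (b k * (Real.log N + |Real.log (b k)| + Λ)) + K1 * a k n := by
      have : a k n * Real.log (N / a k n) ≤ b k / c * (Real.log N + |Real.log (b k)| + Λ) :=
        mul_le_mul hab hxle hx0 (by positivity)
      have h2 : a k n * (2 + α k + ε + K) ≤ a k n * K1 := by gcongr; simp only [K1]; gcongr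
      have h3 := mul_le_mul_of_nonneg_left this hε.le
      have h4 : ε / c * (b k * (Real.log N + |Real.log (b k)| + Λ)) =
        ε * (b k / c * (Real.log N + |Real.log (b k)| + Λ)) := by ring
      rw [h4]
      linarith
    -- Geometric decay in k keeps the bound M log N + 1 on a log(N/a) from being counted n times.
    have hpow : (1 : ℝ) / (h k + 1) ≤ 2 * (1 / 2 ^ k) := by
      have : (2 : ℝ) ^ k ≤ 2 * h k := by exact_mod_cast (hh k hk).2
      rw [mul_one_div, div_le_div_iff₀ (by positivity) (by positivity)]
      linarith
    have hpow1 : (1 : ℝ) / (h k + 1) ≤ 1 := by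
      rw [div_le_one (by positivity)]; linarith [(Nat.cast_nonneg (h k) : (0 : ℝ) ≤ h k)]
    have e2 : a k n * ((α k + ε) * Real.log (N / a k n) + (1 + α k + ε + K)) / (h k + 1) ≤
        (C + ε) * (M * Real.log N + 1) * (2 * (1 / 2 ^ k)) + K1 * a k n := by
      have h1 : (α k + ε) * (a k n * Real.log (N / a k n)) ≤ (C + ε) * (M * Real.log N + 1) := by
        gcongr
      have h2 : a k n * (1 + α k + ε + K) ≤ K1 * a k n := by
        rw [mul_comm]; gcongr; linarith
      calc _ = (α k + ε) * (a k n * Real.log (N / a k n)) * (1 / (h k + 1)) +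
            a k n * (1 + α k + ε + K) * (1 / (h k + 1)) := by ring
        _ ≤ (C + ε) * (M * Real.log N + 1) * (2 * (1 / 2 ^ k)) + K1 * a k n * 1 := by gcongr
        _ = _ := by ring
    have e3 : |a k n * (α k * Real.log (N / a k n)) - (- (b k * Real.log (b k)))| ≤
        (Real.log N + Λ) * b k := by
      have : a k n * (α k * Real.log (N / a k n)) - (- (b k * Real.log (b k))) =
          (Real.log N + Real.log (α k)) * b k := by rw [hlog, hb]; ring
      rw [this, abs_mul, abs_of_pos hbk]
      gcongr
      exact (abs_add_le _ _).trans (by rw [abs_of_nonneg hlN]; gcongr)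
    have := abs_sub_le (truncatedMean (f k) (a k n) N (h k))
      (a k n * (α k * Real.log (N / a k n))) (- (b k * Real.log (b k)))
    linarith
  have hsum : |∑ k ∈ Finset.Icc 1 n, truncatedMean (f k) (a k n) N (h k) -
      (- ∑ k ∈ Finset.Icc 1 n, b k * Real.log (b k))| ≤
      ε / c * B * N + (A * Real.log N + A') := by
    rw [← Finset.sum_neg_distrib, ← Finset.sum_sub_distrib]
    refine (Finset.abs_sum_le_sum_abs _ _).trans ((Finset.sum_le_sum hterm).trans ?_)
    simp only [Finset.sum_add_distrib, ← Finset.mul_sum]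
    have h1 : (ε / c * Real.log N + ε / c * Λ + Real.log N + Λ) * ∑ k ∈ Finset.Icc 1 n, b k ≤
        (ε / c * Real.log N + ε / c * Λ + Real.log N + Λ) * S := by gcongr; exact hS n
    have h2 : ε / c * ∑ k ∈ Finset.Icc 1 n, b k * |Real.log (b k)| ≤ ε / c * (B * N) := by gcongr
    have h3 : 2 * K1 * ∑ k ∈ Finset.Icc 1 n, a k n ≤ 2 * K1 * (S / c) := by gcongr; exact hSc n
    have h4 : (C + ε) * (M * Real.log N + 1) * (2 * ∑ k ∈ Finset.Icc 1 n, (1 : ℝ) / 2 ^ k) ≤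
        (C + ε) * (M * Real.log N + 1) * (2 * 1) := by gcongr; exact sum_Icc_inv_two_pow_le n
    rw [hA, hA']
    linarith
  rw [Real.dist_eq, abs_sub_comm] at hln
  set T := ∑ k ∈ Finset.Icc 1 n, truncatedMean (f k) (a k n) N (h k)
  set U := ∑ k ∈ Finset.Icc 1 n, b k * Real.log (b k)
  have hTU : |1 / N * T - -(U / N)| ≤ ε / c * B + (A * Real.log N + A') / N := by
    have : 1 / N * T - -(U / N) = (T - -U) / N := by field_simp
    rw [this, abs_div, abs_of_pos hN0, div_le_iff₀ hN0, add_mul, div_mul_cancel₀ _ hN0.ne']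
    exact hsum
  have hU : |-(U / N) - ℓ| < η / 4 := by
    have : -(U / N) - ℓ = -ℓ - U / N := by ring
    rw [this]; exact hln
  have := abs_sub_le (1 / N * T) (-(U / N)) ℓ
  linarith

/-! ### Histories and the conditional law of the next digit. -/

/-- The event that `Θ 1, …, Θ n` take the values `h 1, …, h n`. -/
def historyEvent {Ω : Type*} (Θ : ℕ → Ω → ℕ) (n : ℕ) (h : ℕ → ℕ) : Set Ω :=
  {ω | ∀ j ∈ Finset.Icc 1 n, Θ j ω = h j}

/-- The constraints satisfied by the shifted Sylvester digits. -/
def SylvesterAdmissible (n : ℕ) (h : ℕ → ℕ) : Prop :=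
  1 ≤ h 1 ∧ ∀ j ∈ Finset.Icc 2 n, h (j - 1) * (h (j - 1) + 1) ≤ h j

/-- As h(h + 1) ≥ 2h, each step at least doubles the value; this crude rate suffices. -/
theorem SylvesterAdmissible.growth {n : ℕ} {h : ℕ → ℕ} (hh : SylvesterAdmissible n h) {k : ℕ}
    (hk : 1 ≤ k) (hkn : k ≤ n) : 1 ≤ h k ∧ 2 ^ k ≤ 2 * h k := by
  induction k, hk using Nat.le_induction with
  | base => exact ⟨hh.1, by have := hh.1; omega⟩
  | succ k hk ih =>
    obtain ⟨h1, h2⟩ := ih (by omega)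
    have h3 := hh.2 (k + 1) (Finset.mem_Icc.2 ⟨by omega, hkn⟩)
    rw [Nat.add_sub_cancel] at h3
    refine ⟨by nlinarith, ?_⟩
    rw [pow_succ]
    nlinarith

theorem SylvesterAdmissible.mono {m n : ℕ} {h : ℕ → ℕ} (hh : SylvesterAdmissible n h)
    (hmn : m ≤ n) : SylvesterAdmissible m h :=
  ⟨hh.1, fun j hj => hh.2 j (Finset.Icc_subset_Icc_right hmn hj)⟩

/-- The shifted digits of a Sylvester sequence, together with the properties of its distribution
functions that do not involve their slopes at `0`. -/
structure IsSylvesterScheme {Ω : Type*} [MeasurableSpace Ω] (P : Measure Ω)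
    (F : ℕ → ℝ → ℝ) (C : ℝ) (Θ : ℕ → Ω → ℕ) : Prop where
  scheme : IsOppenheimScheme P F (fun _ h => (h : ℝ) * (h + 1)) (fun _ _ => 0) Θ
  nonneg : ∀ n, 1 ≤ n → ∀ u, 0 ≤ F n u
  le_one : ∀ n, 1 ≤ n → ∀ u, F n u ≤ 1
  eq_one : ∀ n, 1 ≤ n → ∀ u, 1 ≤ u → F n u = 1
  le_mul : ∀ n, 1 ≤ n → ∀ u, 0 < u → F n u ≤ C * u

/-- The extension by zero of a finite history. -/
def extendHistory (n : ℕ) (g : Finset.Icc 1 n → ℕ) (j : ℕ) : ℕ :=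
  if hj : j ∈ Finset.Icc 1 n then g ⟨j, hj⟩ else 0

theorem iUnion_historyEvent {Ω : Type*} (Θ : ℕ → Ω → ℕ) (n : ℕ) :
    ⋃ g : Finset.Icc 1 n → ℕ, historyEvent Θ n (extendHistory n g) = Set.univ := by
  refine Set.eq_univ_of_forall fun ω => Set.mem_iUnion.2 ⟨fun j => Θ j ω, fun j hj => ?_⟩
  rw [extendHistory, dif_pos hj]

theorem pairwise_disjoint_historyEvent {Ω : Type*} (Θ : ℕ → Ω → ℕ) (n : ℕ) :
    Pairwise (Function.onFun Disjoint
      fun g : Finset.Icc 1 n → ℕ => historyEvent Θ n (extendHistory n g)) := by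
  intro g g' hne
  refine Set.disjoint_left.2 fun ω h1 h2 => hne (funext fun j => ?_)
  have h3 := h1 j j.2
  rw [h2 j j.2] at h3
  simpa [extendHistory, dif_pos j.2] using h3.symm

theorem SylvesterAdmissible.of_mem_historyEvent {Ω : Type*} {Θ : ℕ → Ω → ℕ} {n : ℕ} (hn : 1 ≤ n) {h : ℕ → ℕ} {ω : Ω}
    (hω : ω ∈ historyEvent Θ n h) (hadm : SylvesterAdmissible n fun j => Θ j ω) :
    SylvesterAdmissible n h := by
  refine ⟨?_, fun j hj => ?_⟩
  · rw [← hω 1 (Finset.mem_Icc.2 ⟨le_rfl, hn⟩)]; exact hadm.1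
  · have h2 := Finset.mem_Icc.1 hj
    rw [← hω j (Finset.mem_Icc.2 ⟨by omega, h2.2⟩),
      ← hω (j - 1) (Finset.mem_Icc.2 ⟨by omega, by omega⟩)]
    exact hadm.2 j hj

section History

variable {Ω : Type*} [MeasurableSpace Ω] {P : Measure Ω} {Θ : ℕ → Ω → ℕ}

theorem measurableSet_historyEvent (hΘ : ∀ n, 1 ≤ n → Measurable (Θ n)) (n : ℕ) (h : ℕ → ℕ) :
    MeasurableSet (historyEvent Θ n h) := by
  have : historyEvent Θ n h = ⋂ j ∈ Finset.Icc 1 n, Θ j ⁻¹' {h j} := by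
    ext ω; simp [historyEvent]
  rw [this]
  exact Finset.measurableSet_biInter _ fun j hj =>
    hΘ j (Finset.mem_Icc.1 hj).1 (measurableSet_singleton _)

/-- Histories form a countable measurable partition, so checking atoms of positive probability takes
the place of conditional expectations. -/
theorem integral_nonneg_of_historyEvent (hΘ : ∀ n, 1 ≤ n → Measurable (Θ n)) (n : ℕ)
    {f : Ω → ℝ} (hf : Integrable f P)
    (h0 : ∀ h, P (historyEvent Θ n h) ≠ 0 → 0 ≤ ∫ ω in historyEvent Θ n h, f ω ∂P) :
    0 ≤ ∫ ω, f ω ∂P := by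
  have hs := hasSum_integral_iUnion (μ := P) (f := f)
    (fun g => measurableSet_historyEvent hΘ n (extendHistory n g))
    (pairwise_disjoint_historyEvent Θ n) hf.integrableOn
  rw [iUnion_historyEvent, Measure.restrict_univ] at hs
  rw [← hs.tsum_eq]
  refine tsum_nonneg fun g => ?_
  by_cases hP : P (historyEvent Θ n (extendHistory n g)) = 0
  · rw [Measure.restrict_eq_zero.2 hP]; simp
  · exact h0 _ hP

theorem ae_of_historyEvent (n : ℕ) {p : Ω → Prop}
    (h0 : ∀ h, P (historyEvent Θ n h) ≠ 0 → P (historyEvent Θ n h ∩ {ω | ¬ p ω}) = 0) :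
    ∀ᵐ ω ∂P, p ω := by
  have : {ω | ¬ p ω} ⊆
      ⋃ g : Finset.Icc 1 n → ℕ, historyEvent Θ n (extendHistory n g) ∩ {ω | ¬ p ω} := by
    rw [← Set.iUnion_inter, iUnion_historyEvent, Set.univ_inter]
  refine measure_mono_null this (measure_iUnion_null fun g => ?_)
  by_cases hP : P (historyEvent Θ n (extendHistory n g)) = 0
  · exact measure_mono_null Set.inter_subset_left hP
  · exact h0 _ hP

theorem exists_mem_historyEvent_of_ae {n : ℕ} {h : ℕ → ℕ} {p : Ω → Prop} (hp : ∀ᵐ ω ∂P, p ω)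
    (hP : P (historyEvent Θ n h) ≠ 0) : ∃ ω ∈ historyEvent Θ n h, p ω := by
  by_contra! hcon
  exact hP (measure_mono_null hcon (ae_iff.1 hp))

end History

namespace IsSylvesterScheme

variable {Ω : Type*} [MeasurableSpace Ω] {P : Measure Ω} [IsProbabilityMeasure P]
  {F : ℕ → ℝ → ℝ} {C : ℝ} {Θ : ℕ → Ω → ℕ}

/-- The point masses are increments of F(y/k), so the tail minus F(y/M) does not depend on M; both
tend to 0 as M → ∞, the latter by the linear bound. -/
theorem cond_tail (hs : IsSylvesterScheme P F C Θ) {n : ℕ} (hn : 1 ≤ n) {h : ℕ → ℕ}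
    (hh : SylvesterAdmissible n h) (hP : P (historyEvent Θ n h) ≠ 0) {m : ℕ} (hm : 1 ≤ m) :
    (P[|historyEvent Θ n h]).real {ω | m ≤ Θ (n + 1) ω} =
      F n ((h n * (h n + 1) : ℕ) / m) := by
  have hΘ := hs.scheme.measurable
  have hy : 1 ≤ h n * (h n + 1) := by
    have := (hh.growth hn le_rfl).1
    nlinarith
  set y := h n * (h n + 1)
  have hy0 : (0 : ℝ) < y := by exact_mod_cast hy
  set Q := P[|historyEvent Θ n h]
  have : IsProbabilityMeasure Q := cond_isProbabilityMeasure hP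
  have hmeas : ∀ M, MeasurableSet {ω | M ≤ Θ (n + 1) ω} := fun M =>
    hΘ (n + 1) (by omega) (measurableSet_Ici (a := M))
  have hpoint : ∀ k, 1 ≤ k → Q.real {ω | Θ (n + 1) ω = k} =
      F n (y / k) - F n (y / (k + 1 : ℕ)) := by
    intro k hk
    -- The conditional law reads the next value from the same sequence as the history; changing
    -- entry n + 1 leaves the history event alone.
    set h' := Function.update h (n + 1) k
    have hne : ∀ j, j ≤ n → h' j = h j := fun j hj =>
      Function.update_of_ne (by omega) _ _
    have hev : {ω | ∀ j ∈ Finset.Icc 1 n, Θ j ω = h' j} = historyEvent Θ n h := by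
      ext ω
      refine forall₂_congr fun j hj => ?_
      rw [hne j (Finset.mem_Icc.1 hj).2]
    have hlast : h' (n + 1) = k := Function.update_self _ _ _
    have := hs.scheme.cond_law n h' hn (by rw [hne 1 hn]; exact hh.1) (fun j hj => by
      rw [hne j (Finset.mem_Icc.1 hj).2, hne (j - 1) (by have := Finset.mem_Icc.1 hj; omega)]
      exact_mod_cast hh.2 j hj) (by rw [hlast]; exact hk) (by rw [hev]; exact hP)
    rw [hev, hlast, hne n le_rfl] at this
    rw [this]
    simp [oppenheimDelta, y]
  have hstep : ∀ k, 1 ≤ k → Q.real {ω | k ≤ Θ (n + 1) ω} - F n (y / k) =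
      Q.real {ω | k + 1 ≤ Θ (n + 1) ω} - F n (y / (k + 1 : ℕ)) := by
    intro k hk
    have hun : {ω | k ≤ Θ (n + 1) ω} = {ω | Θ (n + 1) ω = k} ∪ {ω | k + 1 ≤ Θ (n + 1) ω} := by
      ext ω; simp only [Set.mem_ofPred_eq, Set.mem_union]; omega
    rw [hun, measureReal_union _ (hmeas _), hpoint k hk]
    · ring
    · refine Set.disjoint_left.2 fun ω h1 h2 => ?_
      simp only [Set.mem_ofPred_eq] at h1 h2
      omega
  have hconst : ∀ M, m ≤ M → Q.real {ω | M ≤ Θ (n + 1) ω} - F n (y / M) =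
      Q.real {ω | m ≤ Θ (n + 1) ω} - F n (y / m) := by
    intro M hM
    induction M, hM using Nat.le_induction with
    | base => rfl
    | succ M hM ih => rw [← ih, ← hstep M (hm.trans hM)]
  have hG : Tendsto (fun M : ℕ => Q.real {ω | M ≤ Θ (n + 1) ω}) atTop (𝓝 0) := by
    have h1 := tendsto_measure_iInter_atTop (μ := Q) (s := fun M : ℕ => {ω | M ≤ Θ (n + 1) ω})
      (fun M => (hmeas M).nullMeasurableSet)
      (fun M M' hMM ω (hω : M' ≤ _) => (hMM.trans hω : M ≤ _)) ⟨0, measure_ne_top _ _⟩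
    have h2 : ⋂ M : ℕ, {ω | M ≤ Θ (n + 1) ω} = ∅ := by
      refine Set.eq_empty_of_forall_notMem fun ω hω => ?_
      have := Set.mem_iInter.1 hω (Θ (n + 1) ω + 1)
      simp only [Set.mem_ofPred_eq] at this
      omega
    rw [h2, measure_empty] at h1
    exact (ENNReal.tendsto_toReal_zero_iff (fun _ => measure_ne_top _ _)).2 h1
  have hF : Tendsto (fun M : ℕ => F n (y / M)) atTop (𝓝 0) := by
    have h1 : Tendsto (fun M : ℕ => C * ((y : ℝ) / M)) atTop (𝓝 0) := by
      simpa using (tendsto_const_div_atTop_nhds_zero_nat (y : ℝ)).const_mul C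
    refine tendsto_of_tendsto_of_tendsto_of_le_of_le' tendsto_const_nhds h1
      (Eventually.of_forall fun M => hs.nonneg n hn _) ?_
    filter_upwards [eventually_ge_atTop 1] with M hM
    have : (0 : ℝ) < M := by exact_mod_cast hM
    exact hs.le_mul n hn _ (by positivity)
  have hlim := hG.sub hF
  rw [sub_zero] at hlim
  have := tendsto_nhds_unique hlim (tendsto_const_nhds.congr'
    ((eventually_ge_atTop m).mono fun M hM => (hconst M hM).symm))
  linarith

theorem measureReal_inter_tail (hs : IsSylvesterScheme P F C Θ) {n : ℕ} (hn : 1 ≤ n) {h : ℕ → ℕ}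
    (hh : SylvesterAdmissible n h) (hP : P (historyEvent Θ n h) ≠ 0) {m : ℕ} (hm : 1 ≤ m) :
    P.real (historyEvent Θ n h ∩ {ω | m ≤ Θ (n + 1) ω}) =
      P.real (historyEvent Θ n h) * F n ((h n * (h n + 1) : ℕ) / m) := by
  rw [← hs.cond_tail hn hh hP hm, measureReal_def, measureReal_def, measureReal_def,
    ← cond_mul_eq_inter (measurableSet_historyEvent hs.scheme.measurable n h), ENNReal.toReal_mul,
    mul_comm]

/-- The tail formula at m = y has value F(1) = 1, so the next digit almost surely satisfies its
constraint. -/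
theorem ae_admissible (hs : IsSylvesterScheme P F C Θ) {n : ℕ} (hn : 1 ≤ n) :
    ∀ᵐ ω ∂P, SylvesterAdmissible n fun j => Θ j ω := by
  induction n, hn using Nat.le_induction with
  | base =>
    filter_upwards [hs.scheme.first_pos] with ω hω
    exact ⟨hω, fun j hj => by rw [Finset.mem_Icc] at hj; omega⟩
  | succ n hn ih =>
    have hstep : ∀ᵐ ω ∂P, Θ n ω * (Θ n ω + 1) ≤ Θ (n + 1) ω := by
      refine ae_of_historyEvent (Θ := Θ) n fun h hP => ?_
      -- The tail formula needs an admissible history; one good point in the event shows that `h` is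
      -- admissible.
      obtain ⟨ω₀, hω₀, hadm⟩ := exists_mem_historyEvent_of_ae ih hP
      have hh := SylvesterAdmissible.of_mem_historyEvent hn hω₀ hadm
      have hy : 1 ≤ h n * (h n + 1) := by
        have := (hh.growth hn le_rfl).1
        nlinarith
      have htail := hs.measureReal_inter_tail hn hh hP hy
      rw [div_self (by exact_mod_cast (by omega : h n * (h n + 1) ≠ 0)),
        hs.eq_one n hn 1 le_rfl, mul_one] at htail
      set A := historyEvent Θ n h
      set V := {ω | h n * (h n + 1) ≤ Θ (n + 1) ω}
      have hV : MeasurableSet V :=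
        hs.scheme.measurable (n + 1) (by omega) (measurableSet_Ici (a := h n * (h n + 1)))
      have hnull : P (A \ V) = 0 := by
        have := measureReal_inter_add_sdiff (μ := P) (s := A) hV
        rw [htail] at this
        have h0 : P.real (A \ V) = 0 := by linarith
        exact (measureReal_eq_zero_iff).1 h0
      refine measure_mono_null ?_ hnull
      rintro ω ⟨hωA, hω⟩
      refine ⟨hωA, fun hωV => hω ?_⟩
      rw [hωA n (Finset.mem_Icc.2 ⟨hn, le_rfl⟩)]
      exact hωV
    filter_upwards [ih, hstep] with ω h1 h2
    refine ⟨h1.1, fun j hj => ?_⟩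
    rw [Finset.mem_Icc] at hj
    rcases Nat.lt_or_ge n j with hlt | hge
    · obtain rfl : j = n + 1 := by omega
      simpa using h2
    · exact h1.2 j (Finset.mem_Icc.2 ⟨hj.1, hge⟩)

theorem admissible_of_ne_zero (hs : IsSylvesterScheme P F C Θ) {n : ℕ} (hn : 1 ≤ n) {h : ℕ → ℕ}
    (hP : P (historyEvent Θ n h) ≠ 0) : SylvesterAdmissible n h := by
  obtain ⟨ω₀, hω₀, hadm⟩ := exists_mem_historyEvent_of_ae (hs.ae_admissible hn) hP
  exact SylvesterAdmissible.of_mem_historyEvent hn hω₀ hadm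

theorem setIntegral_ite_tail (hs : IsSylvesterScheme P F C Θ) {n : ℕ} (hn : 1 ≤ n) {h : ℕ → ℕ}
    (hP : P (historyEvent Θ n h) ≠ 0) {m : ℕ} (hm : 1 ≤ m) (c : ℝ) :
    ∫ ω in historyEvent Θ n h, (if m ≤ Θ (n + 1) ω then c else 0) ∂P =
      P.real (historyEvent Θ n h) * (c * F n ((h n * (h n + 1) : ℕ) / m)) := by
  have hV : MeasurableSet {ω | m ≤ Θ (n + 1) ω} :=
    hs.scheme.measurable (n + 1) (by omega) (measurableSet_Ici (a := m))
  have : (fun ω => if m ≤ Θ (n + 1) ω then c else 0) =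
      {ω | m ≤ Θ (n + 1) ω}.indicator fun _ => c := by
    ext ω; simp [Set.indicator_apply]
  rw [this, integral_indicator_const _ hV, measureReal_restrict_apply hV, Set.inter_comm,
    hs.measureReal_inter_tail hn (hs.admissible_of_ne_zero hn hP) hP hm, smul_eq_mul]
  ring

/-- Layer-cake formula: `c m = 1` yields the mean of the truncated term and `c m = 2m + 1` its
second moment. -/
theorem setIntegral_sum_tail (hs : IsSylvesterScheme P F C Θ) {n : ℕ} (hn : 1 ≤ n) {h : ℕ → ℕ}
    (hP : P (historyEvent Θ n h) ≠ 0) (c : ℕ → ℝ) (L : ℕ) :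
    ∫ ω in historyEvent Θ n h,
        (1 + ∑ m ∈ Finset.Icc 1 L, if m ≤ Θ (n + 1) ω then c m else 0) ∂P =
      P.real (historyEvent Θ n h) *
        (1 + ∑ m ∈ Finset.Icc 1 L, c m * F n ((h n * (h n + 1) : ℕ) / m)) := by
  have hint : ∀ m, Integrable (fun ω => if m ≤ Θ (n + 1) ω then c m else 0)
      (P.restrict (historyEvent Θ n h)) := fun m => by
    refine Integrable.of_bound (C := |c m|) ?_ (Eventually.of_forall fun ω => ?_)
    · exact ((Measurable.of_discrete (f := fun v : ℕ => if m ≤ v then c m else 0)).comp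
        (hs.scheme.measurable (n + 1) (by omega))).aestronglyMeasurable
    · split_ifs <;> simp
  rw [integral_add (integrable_const _) (integrable_finsetSum _ fun m _ => hint m),
    integral_finsetSum _ fun m _ => hint m, mul_add, Finset.mul_sum]
  congr 1
  · simp
  · exact Finset.sum_congr rfl fun m hm =>
      hs.setIntegral_ite_tail hn hP (Finset.mem_Icc.1 hm).1 _

end IsSylvesterScheme

/-! ### Truncated terms, orthogonality and second moments. -/

/-- The quantity `a (v + 1) / (h + 1) ^ 2`, with `v` truncated so that it stays at most of order
`N`. -/
noncomputable def truncatedTerm (a N : ℝ) (h v : ℕ) : ℝ :=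
  a / (h + 1) ^ 2 * (1 + (min v ⌊N / a * (h * (h + 1) : ℕ)⌋₊ : ℕ))

theorem sum_Icc_ite_le {M : Type*} [AddCommMonoid M] (c : ℕ → M) (v L : ℕ) :
    ∑ m ∈ Finset.Icc 1 L, (if m ≤ v then c m else 0) = ∑ m ∈ Finset.Icc 1 (min v L), c m := by
  rw [← Finset.sum_filter]
  congr 1
  ext m
  simp only [Finset.mem_filter, Finset.mem_Icc]
  omega

theorem truncatedTerm_eq (a N : ℝ) (h v : ℕ) :
    truncatedTerm a N h v = a / (h + 1) ^ 2 *
      (1 + ∑ m ∈ Finset.Icc 1 ⌊N / a * (h * (h + 1) : ℕ)⌋₊, if m ≤ v then (1 : ℝ) else 0) := by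
  rw [truncatedTerm, sum_Icc_ite_le fun _ => (1 : ℝ)]
  simp

theorem one_add_sum_odd (t : ℕ) :
    1 + ∑ m ∈ Finset.Icc 1 t, (2 * (m : ℝ) + 1) = (1 + t) ^ 2 := by
  induction t with
  | zero => simp
  | succ t ih => rw [Finset.sum_Icc_succ_top (by omega), ← add_assoc, ih]; push_cast; ring

theorem truncatedTerm_sq_eq (a N : ℝ) (h v : ℕ) :
    truncatedTerm a N h v ^ 2 = (a / (h + 1) ^ 2) ^ 2 *
      (1 + ∑ m ∈ Finset.Icc 1 ⌊N / a * (h * (h + 1) : ℕ)⌋₊,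
        if m ≤ v then (2 * (m : ℝ) + 1) else 0) := by
  rw [truncatedTerm, sum_Icc_ite_le fun m : ℕ => 2 * (m : ℝ) + 1, one_add_sum_odd, mul_pow]

theorem weight_mul_one_add_floor_le {a N : ℝ} (ha : 0 < a) (hN : 0 ≤ N) (h : ℕ) :
    a / ((h : ℝ) + 1) ^ 2 * (1 + ⌊N / a * (h * (h + 1) : ℕ)⌋₊) ≤ a + N := by
  have h1 : (⌊N / a * (h * (h + 1) : ℕ)⌋₊ : ℝ) ≤ N / a * (h * (h + 1) : ℕ) :=
    Nat.floor_le (by positivity)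
  have h2 : a * (1 + (⌊N / a * (h * (h + 1) : ℕ)⌋₊ : ℝ)) ≤ a + N * (h * (h + 1)) := by
    calc _ ≤ a * (1 + N / a * (h * (h + 1) : ℕ)) := by gcongr
      _ = _ := by push_cast; field_simp
  rw [div_mul_eq_mul_div, div_le_iff₀ (by positivity)]
  have h3 : (0 : ℝ) ≤ h := Nat.cast_nonneg h
  nlinarith [mul_nonneg ha.le h3, mul_nonneg hN h3, mul_nonneg (mul_nonneg ha.le h3) h3]

theorem truncatedTerm_mem_Icc {a N : ℝ} (ha : 0 < a) (hN : 0 ≤ N) (h v : ℕ) :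
    truncatedTerm a N h v ∈ Set.Icc 0 (a + N) := by
  refine ⟨by rw [truncatedTerm]; positivity, le_trans ?_ (weight_mul_one_add_floor_le ha hN h)⟩
  rw [truncatedTerm]
  gcongr
  exact min_le_right _ _

theorem truncatedMean_mem_Icc {f : ℝ → ℝ} (h0 : ∀ u, 0 ≤ f u) (h1 : ∀ u, f u ≤ 1) {a N : ℝ}
    (ha : 0 < a) (hN : 0 ≤ N) (h : ℕ) : truncatedMean f a N h ∈ Set.Icc 0 (a + N) := by
  refine ⟨?_, le_trans ?_ (weight_mul_one_add_floor_le ha hN h)⟩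
  · have := Finset.sum_nonneg fun m (_ : m ∈ Finset.Icc 1 ⌊N / a * (h * (h + 1) : ℕ)⌋₊) =>
      h0 ((h * (h + 1) : ℕ) / m)
    rw [truncatedMean]
    positivity
  · rw [truncatedMean]
    gcongr
    exact (Finset.sum_le_sum fun m _ => h1 _).trans (by simp)

/-- The truncated term of index `k`, centred at its conditional mean given the past. -/
noncomputable def centredTerm {Ω : Type*} (F : ℕ → ℝ → ℝ) (Θ : ℕ → Ω → ℕ) (a N : ℝ) (k : ℕ)
    (ω : Ω) : ℝ :=
  truncatedTerm a N (Θ k ω) (Θ (k + 1) ω) - truncatedMean (F k) a N (Θ k ω)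

namespace IsSylvesterScheme

variable {Ω : Type*} [MeasurableSpace Ω] {P : Measure Ω}
  {F : ℕ → ℝ → ℝ} {C : ℝ} {Θ : ℕ → Ω → ℕ}

theorem measurable_truncatedTerm (hs : IsSylvesterScheme P F C Θ) {k : ℕ} (hk : 1 ≤ k)
    (a N : ℝ) : Measurable fun ω => truncatedTerm a N (Θ k ω) (Θ (k + 1) ω) :=
  Measurable.comp (g := fun p : ℕ × ℕ => truncatedTerm a N p.1 p.2)
    (f := fun ω => (Θ k ω, Θ (k + 1) ω)) Measurable.of_discrete
    ((hs.scheme.measurable k hk).prodMk (hs.scheme.measurable (k + 1) (by omega)))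

theorem measurable_truncatedMean (hs : IsSylvesterScheme P F C Θ) {k : ℕ} (hk : 1 ≤ k)
    (a N : ℝ) : Measurable fun ω => truncatedMean (F k) a N (Θ k ω) :=
  (Measurable.of_discrete (f := fun v : ℕ => truncatedMean (F k) a N v)).comp
    (hs.scheme.measurable k hk)

theorem measurable_centredTerm (hs : IsSylvesterScheme P F C Θ) {k : ℕ} (hk : 1 ≤ k)
    (a N : ℝ) : Measurable (centredTerm F Θ a N k) :=
  (hs.measurable_truncatedTerm hk a N).sub (hs.measurable_truncatedMean hk a N)

theorem abs_centredTerm_le (hs : IsSylvesterScheme P F C Θ) {k : ℕ} (hk : 1 ≤ k) {a N : ℝ}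
    (ha : 0 < a) (hN : 0 ≤ N) (ω : Ω) : |centredTerm F Θ a N k ω| ≤ a + N := by
  have h1 := truncatedTerm_mem_Icc ha hN (Θ k ω) (Θ (k + 1) ω)
  have h2 := truncatedMean_mem_Icc (hs.nonneg k hk) (hs.le_one k hk) ha hN (Θ k ω)
  rw [centredTerm, abs_le]
  constructor <;> linarith [h1.1, h1.2, h2.1, h2.2]

variable [IsProbabilityMeasure P]

theorem setIntegral_truncatedTerm (hs : IsSylvesterScheme P F C Θ) {k : ℕ} (hk : 1 ≤ k)
    {h : ℕ → ℕ} (hP : P (historyEvent Θ k h) ≠ 0) (a N : ℝ) :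
    ∫ ω in historyEvent Θ k h, truncatedTerm a N (Θ k ω) (Θ (k + 1) ω) ∂P =
      P.real (historyEvent Θ k h) * truncatedMean (F k) a N (h k) := by
  rw [setIntegral_congr_fun (measurableSet_historyEvent hs.scheme.measurable k h)
    (g := fun ω => a / ((h k : ℝ) + 1) ^ 2 *
      (1 + ∑ m ∈ Finset.Icc 1 ⌊N / a * (h k * (h k + 1) : ℕ)⌋₊,
        if m ≤ Θ (k + 1) ω then (1 : ℝ) else 0)), integral_const_mul,
    hs.setIntegral_sum_tail hk hP, truncatedMean]
  · simp only [one_mul]; ring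
  · intro ω hω
    simp only
    rw [hω k (Finset.mem_Icc.2 ⟨hk, le_rfl⟩), truncatedTerm_eq]

/-- The layer weight 2m + 1 ≤ 3m cancels the decay F(y/m) ≤ Cy/m, so each of the at most Ny/a layers
contributes at most 3Cy. The result is linear in N, although the term itself may be of order N. -/
theorem setIntegral_truncatedTerm_sq_le (hs : IsSylvesterScheme P F C Θ) (hC : 0 ≤ C) {k : ℕ}
    (hk : 1 ≤ k) {h : ℕ → ℕ} (hP : P (historyEvent Θ k h) ≠ 0) {a N : ℝ} (ha : 0 < a)
    (hN : 0 ≤ N) :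
    ∫ ω in historyEvent Θ k h, truncatedTerm a N (Θ k ω) (Θ (k + 1) ω) ^ 2 ∂P ≤
      P.real (historyEvent Θ k h) * (a ^ 2 + 3 * C * a * N) := by
  rw [setIntegral_congr_fun (measurableSet_historyEvent hs.scheme.measurable k h)
    (g := fun ω => (a / ((h k : ℝ) + 1) ^ 2) ^ 2 *
      (1 + ∑ m ∈ Finset.Icc 1 ⌊N / a * (h k * (h k + 1) : ℕ)⌋₊,
        if m ≤ Θ (k + 1) ω then (2 * (m : ℝ) + 1) else 0)), integral_const_mul,
    hs.setIntegral_sum_tail hk hP (fun m => 2 * (m : ℝ) + 1), mul_left_comm]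
  swap
  · intro ω hω
    simp only
    rw [hω k (Finset.mem_Icc.2 ⟨hk, le_rfl⟩), truncatedTerm_sq_eq]
  refine mul_le_mul_of_nonneg_left ?_ measureReal_nonneg
  have hh := ((hs.admissible_of_ne_zero hk hP).growth hk le_rfl).1
  have hh0 : (1 : ℝ) ≤ h k := by exact_mod_cast hh
  have hL : (⌊N / a * (h k * (h k + 1) : ℕ)⌋₊ : ℝ) ≤ N / a * (h k * (h k + 1) : ℕ) :=
    Nat.floor_le (by positivity)
  have hsum : ∑ m ∈ Finset.Icc 1 ⌊N / a * (h k * (h k + 1) : ℕ)⌋₊,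
      (2 * (m : ℝ) + 1) * F k ((h k * (h k + 1) : ℕ) / m) ≤
      3 * C * (h k * (h k + 1)) * (N / a * (h k * (h k + 1))) := by
    calc _ ≤ ∑ m ∈ Finset.Icc 1 ⌊N / a * (h k * (h k + 1) : ℕ)⌋₊,
          3 * C * ((h k : ℝ) * (h k + 1)) := by
          refine Finset.sum_le_sum fun m hm => ?_
          have hm1 : (1 : ℝ) ≤ m := by exact_mod_cast (Finset.mem_Icc.1 hm).1
          have hF := hs.le_mul k hk ((h k * (h k + 1) : ℕ) / m) (by positivity)
          calc _ ≤ (3 * (m : ℝ)) * (C * ((h k * (h k + 1) : ℕ) / m)) := by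
                refine mul_le_mul (by linarith) hF (hs.nonneg k hk _) (by positivity)
            _ = _ := by push_cast; field_simp
      _ = 3 * C * ((h k : ℝ) * (h k + 1)) * (⌊N / a * (h k * (h k + 1) : ℕ)⌋₊ : ℝ) := by
          rw [Finset.sum_const, Nat.card_Icc, nsmul_eq_mul, Nat.add_sub_cancel, mul_comm]
      _ ≤ _ := by push_cast at hL ⊢; gcongr
  have hq : (h k : ℝ) * (h k + 1) / (h k + 1) ^ 2 ≤ 1 := by
    rw [div_le_one (by positivity)]; nlinarith
  have hq1 : (1 : ℝ) / (h k + 1) ^ 2 ≤ 1 := by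
    rw [div_le_one (by positivity)]; nlinarith
  calc _ ≤ (a / ((h k : ℝ) + 1) ^ 2) ^ 2 *
        (1 + 3 * C * (h k * (h k + 1)) * (N / a * (h k * (h k + 1)))) := by gcongr
    _ = a ^ 2 * (1 / ((h k : ℝ) + 1) ^ 2) ^ 2 +
        3 * C * a * N * ((h k : ℝ) * (h k + 1) / (h k + 1) ^ 2) ^ 2 := by field_simp
    _ ≤ a ^ 2 * 1 + 3 * C * a * N * 1 := by
        gcongr
        · exact pow_le_one₀ (by positivity) hq1
        · exact pow_le_one₀ (by positivity) hq
    _ = _ := by ring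

/-- Martingale-difference orthogonality: on each atom `G` is constant and the centred term
integrates to 0. -/
theorem integral_centredTerm_mul (hs : IsSylvesterScheme P F C Θ) {k : ℕ} (hk : 1 ≤ k) {a N : ℝ}
    (ha : 0 < a) (hN : 0 ≤ N) {G : Ω → ℝ} (hG : Measurable G) {B : ℝ} (hB : ∀ ω, |G ω| ≤ B)
    (hconst : ∀ ω ω', (∀ j ∈ Finset.Icc 1 k, Θ j ω = Θ j ω') → G ω = G ω') :
    ∫ ω, centredTerm F Θ a N k ω * G ω ∂P = 0 := by
  have hΘ := hs.scheme.measurable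
  have hint : Integrable (fun ω => centredTerm F Θ a N k ω * G ω) P := by
    refine Integrable.of_bound (C := (a + N) * B)
      ((hs.measurable_centredTerm hk a N).mul hG).aestronglyMeasurable
      (Eventually.of_forall fun ω => ?_)
    rw [Real.norm_eq_abs, abs_mul]
    exact mul_le_mul (hs.abs_centredTerm_le hk ha hN ω) (hB ω) (abs_nonneg _) (by positivity)
  have hatom : ∀ h, P (historyEvent Θ k h) ≠ 0 →
      ∫ ω in historyEvent Θ k h, centredTerm F Θ a N k ω * G ω ∂P = 0 := by
    intro h hP
    obtain ⟨ω₀, hω₀⟩ := nonempty_of_measure_ne_zero hP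
    have hTint : Integrable (fun ω => truncatedTerm a N (Θ k ω) (Θ (k + 1) ω))
        (P.restrict (historyEvent Θ k h)) := by
      refine Integrable.of_bound (C := a + N)
        (hs.measurable_truncatedTerm hk a N).aestronglyMeasurable (Eventually.of_forall fun ω => ?_)
      have := truncatedTerm_mem_Icc ha hN (Θ k ω) (Θ (k + 1) ω)
      rw [Real.norm_eq_abs, abs_of_nonneg this.1]
      exact this.2
    rw [setIntegral_congr_fun (measurableSet_historyEvent hΘ k h)
      (g := fun ω => (truncatedTerm a N (Θ k ω) (Θ (k + 1) ω) -
        truncatedMean (F k) a N (h k)) * G ω₀), integral_mul_const,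
      integral_sub hTint (integrable_const _), hs.setIntegral_truncatedTerm hk hP]
    · simp
    · intro ω hω
      simp only [centredTerm]
      rw [hω k (Finset.mem_Icc.2 ⟨hk, le_rfl⟩),
        hconst ω ω₀ fun j hj => (hω j hj).trans (hω₀ j hj).symm]
  refine le_antisymm ?_ (integral_nonneg_of_historyEvent hΘ k hint fun h hP => (hatom h hP).ge)
  have := integral_nonneg_of_historyEvent hΘ k hint.neg fun h hP => by
    simp only [Pi.neg_apply, integral_neg, hatom h hP, neg_zero, le_refl]
  simp only [Pi.neg_apply, integral_neg] at this
  linarith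

theorem integral_truncatedTerm_sq_le (hs : IsSylvesterScheme P F C Θ) (hC : 0 ≤ C) {k : ℕ}
    (hk : 1 ≤ k) {a N : ℝ} (ha : 0 < a) (hN : 0 ≤ N) :
    ∫ ω, truncatedTerm a N (Θ k ω) (Θ (k + 1) ω) ^ 2 ∂P ≤ a ^ 2 + 3 * C * a * N := by
  have hint : Integrable (fun ω => truncatedTerm a N (Θ k ω) (Θ (k + 1) ω) ^ 2) P := by
    refine Integrable.of_bound (C := (a + N) ^ 2)
      ((hs.measurable_truncatedTerm hk a N).pow_const 2).aestronglyMeasurable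
      (Eventually.of_forall fun ω => ?_)
    have := truncatedTerm_mem_Icc ha hN (Θ k ω) (Θ (k + 1) ω)
    rw [Real.norm_eq_abs, abs_of_nonneg (sq_nonneg _)]
    exact pow_le_pow_left₀ this.1 this.2 2
  have := integral_nonneg_of_historyEvent (P := P) hs.scheme.measurable k
    ((integrable_const (a ^ 2 + 3 * C * a * N)).sub hint) fun h hP => by
      simp only [Pi.sub_apply]
      rw [integral_sub (integrable_const _) hint.integrableOn, setIntegral_const, smul_eq_mul]
      linarith [hs.setIntegral_truncatedTerm_sq_le hC hk hP ha hN]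
  simp only [Pi.sub_apply] at this
  rw [integral_sub (integrable_const _) hint] at this
  simp only [integral_const, probReal_univ, one_smul] at this
  linarith

/-- Pythagoras: the centred term is orthogonal to its own conditional mean, so centring does not
increase the second moment. -/
theorem integral_centredTerm_sq_le (hs : IsSylvesterScheme P F C Θ) (hC : 0 ≤ C) {k : ℕ}
    (hk : 1 ≤ k) {a N : ℝ} (ha : 0 < a) (hN : 0 ≤ N) :
    ∫ ω, centredTerm F Θ a N k ω ^ 2 ∂P ≤ a ^ 2 + 3 * C * a * N := by
  have hmean : ∀ ω, |truncatedMean (F k) a N (Θ k ω)| ≤ a + N := fun ω => by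
    have := truncatedMean_mem_Icc (hs.nonneg k hk) (hs.le_one k hk) ha hN (Θ k ω)
    rw [abs_of_nonneg this.1]
    exact this.2
  have horth := hs.integral_centredTerm_mul hk ha hN (hs.measurable_truncatedMean hk a N) hmean
    fun ω ω' h => by rw [h k (Finset.mem_Icc.2 ⟨hk, le_rfl⟩)]
  have hi1 : Integrable (fun ω => centredTerm F Θ a N k ω ^ 2) P := by
    refine Integrable.of_bound (C := (a + N) ^ 2)
      ((hs.measurable_centredTerm hk a N).pow_const 2).aestronglyMeasurable
      (Eventually.of_forall fun ω => ?_)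
    rw [Real.norm_eq_abs, abs_pow]
    exact pow_le_pow_left₀ (abs_nonneg _) (hs.abs_centredTerm_le hk ha hN ω) 2
  have hi2 : Integrable (fun ω => truncatedMean (F k) a N (Θ k ω) ^ 2) P := by
    refine Integrable.of_bound (C := (a + N) ^ 2)
      ((hs.measurable_truncatedMean hk a N).pow_const 2).aestronglyMeasurable
      (Eventually.of_forall fun ω => ?_)
    rw [Real.norm_eq_abs, abs_pow]
    exact pow_le_pow_left₀ (abs_nonneg _) (hmean ω) 2
  have hi3 : Integrable
      (fun ω => centredTerm F Θ a N k ω * truncatedMean (F k) a N (Θ k ω)) P := by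
    refine Integrable.of_bound (C := (a + N) * (a + N))
      ((hs.measurable_centredTerm hk a N).mul
        (hs.measurable_truncatedMean hk a N)).aestronglyMeasurable
      (Eventually.of_forall fun ω => ?_)
    rw [Real.norm_eq_abs, abs_mul]
    exact mul_le_mul (hs.abs_centredTerm_le hk ha hN ω) (hmean ω) (abs_nonneg _) (by positivity)
  have hexp : ∫ ω, truncatedTerm a N (Θ k ω) (Θ (k + 1) ω) ^ 2 ∂P =
      ∫ ω, centredTerm F Θ a N k ω ^ 2 ∂P + ∫ ω, truncatedMean (F k) a N (Θ k ω) ^ 2 ∂P := by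
    have : ∀ ω, truncatedTerm a N (Θ k ω) (Θ (k + 1) ω) ^ 2 =
        (centredTerm F Θ a N k ω ^ 2 + truncatedMean (F k) a N (Θ k ω) ^ 2) +
          2 * (centredTerm F Θ a N k ω * truncatedMean (F k) a N (Θ k ω)) := fun ω => by
      rw [centredTerm]; ring
    have hi12 : Integrable
        (fun ω => centredTerm F Θ a N k ω ^ 2 + truncatedMean (F k) a N (Θ k ω) ^ 2) P :=
      hi1.add hi2
    simp only [this]
    rw [integral_add hi12 (hi3.const_mul 2), integral_const_mul, horth,
      integral_add hi1 hi2]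
    ring
  have h0 : 0 ≤ ∫ ω, truncatedMean (F k) a N (Θ k ω) ^ 2 ∂P := integral_nonneg fun ω => sq_nonneg _
  linarith [hs.integral_truncatedTerm_sq_le hC hk ha hN]

theorem integral_sum_centredTerm_sq_le (hs : IsSylvesterScheme P F C Θ) (hC : 0 ≤ C) {n : ℕ}
    {a : ℕ → ℝ} {N : ℝ} (ha : ∀ k ∈ Finset.Icc 1 n, 0 < a k) (hN : 0 ≤ N) :
    Integrable (fun ω => (∑ k ∈ Finset.Icc 1 n, centredTerm F Θ (a k) N k ω) ^ 2) P ∧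
    ∫ ω, (∑ k ∈ Finset.Icc 1 n, centredTerm F Θ (a k) N k ω) ^ 2 ∂P ≤
      ∑ k ∈ Finset.Icc 1 n, (a k ^ 2 + 3 * C * a k * N) := by
  induction n with
  | zero => simp
  | succ n ih =>
    have ha' : ∀ k ∈ Finset.Icc 1 n, 0 < a k := fun k hk =>
      ha k (Finset.Icc_subset_Icc_right n.le_succ hk)
    obtain ⟨hint, hle⟩ := ih ha'
    have hn : 1 ≤ n + 1 := by omega
    have han := ha (n + 1) (Finset.mem_Icc.2 ⟨hn, le_rfl⟩)
    have hGm : Measurable fun ω => ∑ k ∈ Finset.Icc 1 n, centredTerm F Θ (a k) N k ω :=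
      Finset.measurable_fun_sum _ fun k hk =>
        hs.measurable_centredTerm (Finset.mem_Icc.1 hk).1 _ _
    have hGb : ∀ ω, |∑ k ∈ Finset.Icc 1 n, centredTerm F Θ (a k) N k ω| ≤
        ∑ k ∈ Finset.Icc 1 n, (a k + N) := fun ω =>
      (Finset.abs_sum_le_sum_abs _ _).trans (Finset.sum_le_sum fun k hk =>
        hs.abs_centredTerm_le (Finset.mem_Icc.1 hk).1 (ha' k hk) hN ω)
    -- Term k depends on Θ up to index k + 1 ≤ n + 1, so the partial sum is a function of the
    -- history preceding the new term.
    have horth := hs.integral_centredTerm_mul hn han hN hGm hGb fun ω ω' h => by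
      refine Finset.sum_congr rfl fun k hk => ?_
      rw [Finset.mem_Icc] at hk
      rw [centredTerm, centredTerm, h k (Finset.mem_Icc.2 ⟨hk.1, by omega⟩),
        h (k + 1) (Finset.mem_Icc.2 ⟨by omega, by omega⟩)]
    have hi1 : Integrable (fun ω => centredTerm F Θ (a (n + 1)) N (n + 1) ω ^ 2) P := by
      refine Integrable.of_bound (C := (a (n + 1) + N) ^ 2)
        ((hs.measurable_centredTerm hn _ N).pow_const 2).aestronglyMeasurable
        (Eventually.of_forall fun ω => ?_)
      rw [Real.norm_eq_abs, abs_pow]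
      exact pow_le_pow_left₀ (abs_nonneg _) (hs.abs_centredTerm_le hn han hN ω) 2
    have hi3 : Integrable (fun ω => centredTerm F Θ (a (n + 1)) N (n + 1) ω *
        ∑ k ∈ Finset.Icc 1 n, centredTerm F Θ (a k) N k ω) P := by
      refine Integrable.of_bound (C := (a (n + 1) + N) * ∑ k ∈ Finset.Icc 1 n, (a k + N))
        ((hs.measurable_centredTerm hn _ N).mul hGm).aestronglyMeasurable
        (Eventually.of_forall fun ω => ?_)
      rw [Real.norm_eq_abs, abs_mul]
      exact mul_le_mul (hs.abs_centredTerm_le hn han hN ω) (hGb ω) (abs_nonneg _) (by positivity)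
    have hexp : (fun ω => (∑ k ∈ Finset.Icc 1 (n + 1), centredTerm F Θ (a k) N k ω) ^ 2) =
        fun ω => ((∑ k ∈ Finset.Icc 1 n, centredTerm F Θ (a k) N k ω) ^ 2 +
          centredTerm F Θ (a (n + 1)) N (n + 1) ω ^ 2) +
          2 * (centredTerm F Θ (a (n + 1)) N (n + 1) ω *
            ∑ k ∈ Finset.Icc 1 n, centredTerm F Θ (a k) N k ω) := by
      ext ω
      rw [Finset.sum_Icc_succ_top hn]
      ring
    have hi12 : Integrable (fun ω => (∑ k ∈ Finset.Icc 1 n, centredTerm F Θ (a k) N k ω) ^ 2 +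
        centredTerm F Θ (a (n + 1)) N (n + 1) ω ^ 2) P := hint.add hi1
    rw [hexp]
    refine ⟨hi12.add (hi3.const_mul 2), ?_⟩
    rw [integral_add hi12 (hi3.const_mul 2), integral_const_mul, horth,
      integral_add hint hi1, Finset.sum_Icc_succ_top hn]
    linarith [hs.integral_centredTerm_sq_le hC hn han hN]

/-- Exceeding L = ⌊Ny/a⌋ has conditional probability F(y/(L + 1)), and L + 1 > Ny/a, so the history
cancels from the bound. -/
theorem measureReal_exceed_le (hs : IsSylvesterScheme P F C Θ) {k : ℕ} (hk : 1 ≤ k)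
    (hC : 0 ≤ C) {a N : ℝ} (ha : 0 < a) (hN : 0 < N) :
    P.real {ω | ⌊N / a * (Θ k ω * (Θ k ω + 1) : ℕ)⌋₊ < Θ (k + 1) ω} ≤ C * (a / N) := by
  have hΘ := hs.scheme.measurable
  set E := {ω | ⌊N / a * (Θ k ω * (Θ k ω + 1) : ℕ)⌋₊ < Θ (k + 1) ω} with hE
  have hEm : MeasurableSet E :=
    measurableSet_lt ((Measurable.of_discrete
      (f := fun v : ℕ => ⌊N / a * (v * (v + 1) : ℕ)⌋₊)).comp (hΘ k hk)) (hΘ (k + 1) (by omega))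
  have hint : Integrable (E.indicator fun _ => (1 : ℝ)) P := (integrable_const _).indicator hEm
  have := integral_nonneg_of_historyEvent (P := P) hΘ k
    ((integrable_const (C * (a / N))).sub hint) fun h hP => by
      simp only [Pi.sub_apply]
      rw [integral_sub (integrable_const _) hint.integrableOn, setIntegral_const, smul_eq_mul,
        integral_indicator_const _ hEm, measureReal_restrict_apply hEm, smul_eq_mul, mul_one,
        Set.inter_comm]
      set L := ⌊N / a * (h k * (h k + 1) : ℕ)⌋₊ with hL
      have hset : historyEvent Θ k h ∩ E =
          historyEvent Θ k h ∩ {ω | L + 1 ≤ Θ (k + 1) ω} := by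
        ext ω
        refine and_congr_right fun hω => ?_
        simp only [hE, hL, Set.mem_ofPred_eq, hω k (Finset.mem_Icc.2 ⟨hk, le_rfl⟩),
          Nat.succ_le_iff]
      have hh := hs.admissible_of_ne_zero hk hP
      have hh1 := (hh.growth hk le_rfl).1
      rw [hset, hs.measureReal_inter_tail hk hh hP (by omega), ← mul_sub]
      refine mul_nonneg measureReal_nonneg (sub_nonneg.2 ?_)
      refine (hs.le_mul k hk _ (by positivity)).trans ?_
      refine mul_le_mul_of_nonneg_left ?_ hC
      have h1 : N / a * (h k * (h k + 1) : ℕ) < L + 1 := Nat.lt_floor_add_one _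
      rw [div_le_div_iff₀ (by positivity) hN]
      rw [div_mul_eq_mul_div, div_lt_iff₀ ha] at h1
      push_cast at h1 ⊢
      linarith
  simp only [Pi.sub_apply] at this
  rw [integral_sub (integrable_const _) hint, integral_indicator_const _ hEm] at this
  simp only [integral_const, probReal_univ, smul_eq_mul, mul_one] at this
  linarith

end IsSylvesterScheme

/-! ### Convergence in probability. -/

theorem truncatedTerm_of_le {a N : ℝ} {h v : ℕ} (hv : v ≤ ⌊N / a * (h * (h + 1) : ℕ)⌋₊) :
    truncatedTerm a N h v = a * (((v : ℝ) + 1) / ((h : ℝ) + 1) ^ 2) := by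
  rw [truncatedTerm, min_eq_left hv]
  ring

namespace IsSylvesterScheme

variable {Ω : Type*} [MeasurableSpace Ω] {P : Measure Ω} [IsProbabilityMeasure P]
  {F : ℕ → ℝ → ℝ} {C : ℝ} {Θ : ℕ → Ω → ℕ}

theorem measureReal_sum_centredTerm_ge_le (hs : IsSylvesterScheme P F C Θ) (hC : 0 ≤ C) {n : ℕ}
    {a : ℕ → ℝ} {N : ℝ} (ha : ∀ k ∈ Finset.Icc 1 n, 0 < a k) (hN : 0 ≤ N) {t : ℝ} (ht : 0 < t) :
    P.real {ω | t ≤ |∑ k ∈ Finset.Icc 1 n, centredTerm F Θ (a k) N k ω|} ≤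
      (∑ k ∈ Finset.Icc 1 n, (a k ^ 2 + 3 * C * a k * N)) / t ^ 2 := by
  obtain ⟨hint, hle⟩ := hs.integral_sum_centredTerm_sq_le hC ha hN
  have hm := mul_meas_ge_le_integral_of_nonneg (Eventually.of_forall fun ω => sq_nonneg _) hint
    (t ^ 2)
  have hset : {ω | t ≤ |∑ k ∈ Finset.Icc 1 n, centredTerm F Θ (a k) N k ω|} =
      {ω | t ^ 2 ≤ (∑ k ∈ Finset.Icc 1 n, centredTerm F Θ (a k) N k ω) ^ 2} := by
    ext ω
    simp only [Set.mem_ofPred_eq]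
    rw [← sq_abs (∑ k ∈ Finset.Icc 1 n, centredTerm F Θ (a k) N k ω),
      pow_le_pow_iff_left₀ ht.le (abs_nonneg _) two_ne_zero]
  rw [hset, le_div_iff₀ (by positivity), mul_comm]
  exact hm.trans hle

theorem tendstoInMeasure (hs : IsSylvesterScheme P F C Θ) (hC : 0 ≤ C) {α : ℕ → ℝ}
    {a : ℕ → ℕ → ℝ} {ρ : ℕ → ℝ} {ℓ c C' : ℝ} (hw : WeightConditions α a ρ ℓ) (hc : 0 < c)
    (hα : ∀ k, 1 ≤ k → c ≤ α k ∧ α k ≤ C')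
    (hF : ∀ ε : ℝ, 0 < ε → ∃ K : ℝ, 0 ≤ K ∧ ∀ k, 1 ≤ k → ∀ u, 0 < u →
      |F k u - α k * u| ≤ ε * u + K * u ^ 2) :
    TendstoInMeasure P
      (fun (n : ℕ) (ω : Ω) => 1 / (ρ n * Real.log n) *
        ∑ k ∈ Finset.Icc 1 n, a k n * (((Θ (k + 1) ω : ℝ) + 1) / ((Θ k ω : ℝ) + 1) ^ 2))
      atTop (fun _ => ℓ) := by
  rw [tendstoInMeasure_iff_measureReal_dist]
  intro ε hε
  obtain ⟨S, M, hS0, hM0, hM, -, hSc⟩ := hw.exists_bounds hc fun k hk => (hα k hk).1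
  -- The two constants bound the truncation event `E` and the Chebyshev event `V`; the 4 comes from
  -- the threshold ε/2.
  have hlim : Tendsto (fun n : ℕ => (C * (S / c) + 4 * (M + 3 * C) * (S / c) / ε ^ 2) /
      (ρ n * Real.log n)) atTop (𝓝 0) := hw.norm_tendsto.const_div_atTop _
  refine tendsto_of_tendsto_of_tendsto_of_le_of_le' tendsto_const_nhds hlim
    (Eventually.of_forall fun n => measureReal_nonneg) ?_
  filter_upwards [hw.eventually_sum_truncatedMean hc hα hs.eq_one hF (half_pos hε),
    hw.norm_tendsto.eventually_ge_atTop 1, eventually_ge_atTop 1] with n hmean hN1 hn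
  set N := ρ n * Real.log n
  have hN0 : 0 < N := by linarith
  have ha : ∀ k ∈ Finset.Icc 1 n, 0 < a k n := fun k hk =>
    hw.pos n k (Finset.mem_Icc.1 hk).1 (Finset.mem_Icc.1 hk).2
  set E : Set Ω := ⋃ k ∈ Finset.Icc 1 n,
    {ω | ⌊N / a k n * (Θ k ω * (Θ k ω + 1) : ℕ)⌋₊ < Θ (k + 1) ω} with hE
  set V : Set Ω := {ω | N * (ε / 2) ≤
    |∑ k ∈ Finset.Icc 1 n, centredTerm F Θ (a k n) N k ω|} with hV
  have hPE : P.real E ≤ C * (S / c) / N := by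
    calc P.real E ≤ ∑ k ∈ Finset.Icc 1 n,
          P.real {ω | ⌊N / a k n * (Θ k ω * (Θ k ω + 1) : ℕ)⌋₊ < Θ (k + 1) ω} :=
          measureReal_biUnion_finset_le _ _
      _ ≤ ∑ k ∈ Finset.Icc 1 n, C * (a k n / N) := Finset.sum_le_sum fun k hk =>
          hs.measureReal_exceed_le (Finset.mem_Icc.1 hk).1 hC (ha k hk) hN0
      _ = C * (∑ k ∈ Finset.Icc 1 n, a k n) / N := by
          rw [← Finset.mul_sum, ← Finset.sum_div, mul_div_assoc]
      _ ≤ _ := by gcongr; exact hSc n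
  have hPV : P.real V ≤ 4 * (M + 3 * C) * (S / c) / ε ^ 2 / N := by
    have h1 := hs.measureReal_sum_centredTerm_ge_le hC (a := fun k => a k n) ha hN0.le
      (t := N * (ε / 2)) (by positivity)
    have h2 : ∑ k ∈ Finset.Icc 1 n, (a k n ^ 2 + 3 * C * a k n * N) ≤
        (M + 3 * C) * (S / c) * N := by
      calc _ ≤ ∑ k ∈ Finset.Icc 1 n, (M + 3 * C) * a k n * N := by
            refine Finset.sum_le_sum fun k hk => ?_
            have hak := ha k hk
            have haM := hM n k (Finset.mem_Icc.1 hk).1 (Finset.mem_Icc.1 hk).2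
            have : a k n ^ 2 ≤ M * a k n * N := by
              calc a k n ^ 2 = a k n * a k n * 1 := by ring
                _ ≤ M * a k n * N := by gcongr
            linarith
        _ = (M + 3 * C) * (∑ k ∈ Finset.Icc 1 n, a k n) * N := by
            rw [← Finset.sum_mul, ← Finset.mul_sum]
        _ ≤ _ := by gcongr; exact hSc n
    calc P.real V ≤ _ := h1
      _ ≤ (M + 3 * C) * (S / c) * N / (N * (ε / 2)) ^ 2 := by gcongr
      _ = _ := by field_simp; ring
  -- The inclusion holds only almost surely, since the estimate of the conditional means needs an
  -- admissible history.
  have hsub : ∀ᵐ ω ∂P, ω ∈ {ω | ε ≤ dist (1 / N * ∑ k ∈ Finset.Icc 1 n,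
      a k n * (((Θ (k + 1) ω : ℝ) + 1) / ((Θ k ω : ℝ) + 1) ^ 2)) ℓ} → ω ∈ E ∪ V := by
    filter_upwards [hs.ae_admissible hn] with ω hadm hω
    by_contra hcon
    rw [Set.mem_union, not_or] at hcon
    obtain ⟨hnE, hnV⟩ := hcon
    have hterm : ∀ k ∈ Finset.Icc 1 n,
        a k n * (((Θ (k + 1) ω : ℝ) + 1) / ((Θ k ω : ℝ) + 1) ^ 2) =
          centredTerm F Θ (a k n) N k ω + truncatedMean (F k) (a k n) N (Θ k ω) := by
      intro k hk
      have hle : Θ (k + 1) ω ≤ ⌊N / a k n * (Θ k ω * (Θ k ω + 1) : ℕ)⌋₊ := by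
        by_contra! hlt
        exact hnE (Set.mem_biUnion (by simpa using hk) hlt)
      rw [centredTerm, sub_add_cancel, truncatedTerm_of_le hle]
    have hmω := hmean (fun k => Θ k ω) fun k hk =>
      hadm.growth (Finset.mem_Icc.1 hk).1 (Finset.mem_Icc.1 hk).2
    have hVω : |∑ k ∈ Finset.Icc 1 n, centredTerm F Θ (a k n) N k ω| < N * (ε / 2) :=
      not_le.1 hnV
    have hWω : |1 / N * ∑ k ∈ Finset.Icc 1 n, centredTerm F Θ (a k n) N k ω| < ε / 2 := by
      rw [one_div_mul_eq_div, abs_div, abs_of_pos hN0, div_lt_iff₀ hN0]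
      linarith
    rw [Finset.sum_congr rfl hterm, Finset.sum_add_distrib, Real.dist_eq,
      mul_add, add_sub_assoc] at hω
    have := abs_add_le (1 / N * ∑ k ∈ Finset.Icc 1 n, centredTerm F Θ (a k n) N k ω)
      (1 / N * ∑ k ∈ Finset.Icc 1 n, truncatedMean (F k) (a k n) N (Θ k ω) - ℓ)
    linarith
  calc _ ≤ P.real (E ∪ V) := ENNReal.toReal_mono (measure_ne_top _ _) (measure_mono_ae hsub)
    _ ≤ P.real E + P.real V := measureReal_union_le _ _
    _ ≤ _ := by rw [add_div]; linarith

end IsSylvesterScheme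

theorem IsSylvesterSequence.tendstoInMeasure {Ω : Type*} [MeasurableSpace Ω] {P : Measure Ω}
    [IsProbabilityMeasure P] {ν : ℕ → Measure ℝ} [∀ n, IsProbabilityMeasure (ν n)] {α : ℕ → ℝ}
    {D : ℕ → Ω → ℕ} {a : ℕ → ℕ → ℝ} {ρ : ℕ → ℝ} {ℓ : ℝ}
    (hν : ∀ n, 1 ≤ n → cdf (ν n) 1 = 1)
    (hreg : RegularAtZero (fun n t => cdf (ν n) t) α) (hw : WeightConditions α a ρ ℓ)
    (hD : IsSylvesterSequence P (fun n t => cdf (ν n) t) D) :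
    TendstoInMeasure P
      (fun (n : ℕ) (ω : Ω) => 1 / (ρ n * Real.log n) *
        ∑ k ∈ Finset.Icc 1 n, a k n * ((D (k + 1) ω : ℝ) / (D k ω : ℝ) ^ 2))
      atTop (fun _ => ℓ) := by
  have h0 : ∀ n, 1 ≤ n → ∀ u, 0 ≤ cdf (ν n) u := fun n _ u => cdf_nonneg _ _
  have h1 : ∀ n, 1 ≤ n → ∀ u, cdf (ν n) u ≤ 1 := fun n _ u => cdf_le_one _ _
  obtain ⟨c, C', hc, hα⟩ := hreg.exists_slope_bounds
  obtain ⟨C, hC, hlin⟩ := hreg.exists_linear_bound h1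
  have hs : IsSylvesterScheme P (fun n t => cdf (ν n) t) C fun n ω => D n ω - 1 :=
    { scheme := hD.scheme
      nonneg := h0
      le_one := h1
      eq_one := fun n hn u hu =>
        le_antisymm (cdf_le_one _ _) ((hν n hn).ge.trans (monotone_cdf _ hu))
      le_mul := hlin }
  have hmain := hs.tendstoInMeasure hC.le hw hc hα
    fun ε hε => hreg.exists_quadratic_bound h0 h1 hε
  have hae : ∀ᵐ ω ∂P, ∀ n, 1 ≤ n → SylvesterAdmissible n fun j => D j ω - 1 :=
    ae_all_iff.2 fun n => by
      by_cases hn : 1 ≤ n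
      · simpa [hn] using hs.ae_admissible hn
      · simp [hn]
  refine hmain.congr_left fun n => ?_
  filter_upwards [hae] with ω hω
  -- Admissibility gives D ≥ 2, so the natural subtraction does not truncate.
  have hcast : ∀ k, 1 ≤ k → ((D k ω - 1 : ℕ) : ℝ) + 1 = D k ω := fun k hk => by
    have := ((hω k hk).growth hk le_rfl).1
    exact_mod_cast Nat.sub_add_cancel (by omega)
  congr 1
  refine Finset.sum_congr rfl fun k hk => ?_
  have hk1 := (Finset.mem_Icc.1 hk).1
  rw [hcast k hk1, hcast (k + 1) (by omega)]

/-! ### The classical Sylvester digits under Lebesgue measure. -/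

instance isProbabilityMeasure_volume_restrict_Icc :
    IsProbabilityMeasure (volume.restrict (Set.Icc (0 : ℝ) 1)) :=
  ⟨by simp⟩

theorem cdf_volume_restrict_Icc {t : ℝ} (ht : 0 ≤ t) :
    cdf (volume.restrict (Set.Icc (0 : ℝ) 1)) t = min t 1 := by
  rw [cdf_eq_real, measureReal_restrict_apply measurableSet_Iic]
  have : Set.Iic t ∩ Set.Icc 0 1 = Set.Icc 0 (min t 1) := by
    ext x
    simp only [Set.mem_inter_iff, Set.mem_Iic, Set.mem_Icc, le_min_iff]
    tauto
  rw [this, Real.volume_real_Icc_of_le (le_min ht zero_le_one), sub_zero]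

theorem regularAtZero_cdf_volume_restrict_Icc :
    RegularAtZero (fun _ t => cdf (volume.restrict (Set.Icc (0 : ℝ) 1)) t) fun _ => 1 := by
  have hdiff : ∀ u : ℝ, 0 < u → u < 1 →
      cdf (volume.restrict (Set.Icc (0 : ℝ) 1)) u / u - 1 = 0 := fun u hu hu1 => by
    rw [cdf_volume_restrict_Icc hu.le, min_eq_left hu1.le, div_self hu.ne', sub_self]
  refine ⟨fun _ _ => one_pos, by simp, ?_, ?_, ?_⟩
  · simp only [limsup_const]
    exact EReal.coe_lt_top 1
  · refine tendsto_const_nhds.congr' ?_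
    filter_upwards [Ioo_mem_nhdsGT (zero_lt_one' ℝ)] with t ht
    simp [hdiff t ht.1 ht.2]
  · refine tendsto_const_nhds.congr' ?_
    filter_upwards [Ioo_mem_nhdsGT (zero_lt_one' ℝ)] with t ht
    have : ∫⁻ u in Set.Ioo 0 t, ENNReal.ofReal
        (1 / u * |cdf (volume.restrict (Set.Icc (0 : ℝ) 1)) u / u - 1|) = 0 := by
      rw [setLIntegral_congr_fun (g := fun _ => 0) measurableSet_Ioo]
      · simp
      · intro u hu
        simp [hdiff u hu.1 (hu.2.trans ht.2)]
    simp only [this]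
    simp

theorem measurable_sylvesterRemainder (n : ℕ) : Measurable fun x => sylvesterRemainder x n := by
  induction n with
  | zero => exact measurable_id
  | succ n ih =>
    have h1 : Measurable fun x => ⌊1 / sylvesterRemainder x n⌋₊ := (ih.const_div 1).nat_floor
    have h2 : Measurable fun x => (⌊1 / sylvesterRemainder x n⌋₊ : ℝ) :=
      (Measurable.of_discrete (f := fun m : ℕ => (m : ℝ))).comp h1
    exact ih.sub ((h2.add_const 1).const_div 1)

theorem measurable_sylvesterDigit (n : ℕ) : Measurable (sylvesterDigit n) :=
  (((measurable_sylvesterRemainder (n - 1)).const_div 1).nat_floor).add_const 1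

theorem floor_one_div_eq_iff {h : ℕ} (hh : 1 ≤ h) (r : ℝ) :
    ⌊1 / r⌋₊ = h ↔ r ∈ Set.Ioc (1 / ((h : ℝ) + 1)) (1 / h) := by
  have hh0 : (0 : ℝ) < h := by exact_mod_cast hh
  rw [Nat.floor_eq_iff' (by omega), Set.mem_Ioc]
  constructor
  · rintro ⟨h1, h2⟩
    have hr : 0 < r := one_div_pos.1 (hh0.trans_le h1)
    exact ⟨(one_div_lt (by positivity) hr).2 h2, (le_one_div hr hh0).2 h1⟩
  · rintro ⟨h1, h2⟩
    have hr : 0 < r := lt_trans (by positivity) h1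
    exact ⟨(le_one_div hr hh0).1 h2, (one_div_lt (by positivity) hr).1 h1⟩

theorem sylvesterDigit_succ_sub_one (n : ℕ) (x : ℝ) :
    sylvesterDigit (n + 1) x - 1 = ⌊1 / sylvesterRemainder x n⌋₊ := by
  simp [sylvesterDigit]

theorem sylvesterRemainder_of_mem_historyEvent {n : ℕ} {h : ℕ → ℕ} {x : ℝ}
    (hx : x ∈ historyEvent (fun n x => sylvesterDigit n x - 1) n h) :
    sylvesterRemainder x n = x - ∑ j ∈ Finset.Icc 1 n, 1 / ((h j : ℝ) + 1) := by
  induction n with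
  | zero => simp [sylvesterRemainder]
  | succ n ih =>
    have h1 : sylvesterDigit (n + 1) x - 1 = h (n + 1) := hx (n + 1) (Finset.mem_Icc.2 ⟨by omega, le_rfl⟩)
    rw [sylvesterDigit_succ_sub_one] at h1
    rw [sylvesterRemainder, h1, ih fun j hj => hx j (Finset.Icc_subset_Icc_right n.le_succ hj),
      Finset.sum_Icc_succ_top (by omega)]
    ring

theorem mem_historyEvent_succ {Ω : Type*} {Θ : ℕ → Ω → ℕ} {n : ℕ} {h : ℕ → ℕ} {ω : Ω} :
    ω ∈ historyEvent Θ (n + 1) h ↔ ω ∈ historyEvent Θ n h ∧ Θ (n + 1) ω = h (n + 1) := by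
  have hins : Finset.Icc 1 (n + 1) = insert (n + 1) (Finset.Icc 1 n) := by
    ext j; simp only [Finset.mem_insert, Finset.mem_Icc]; omega
  simp only [historyEvent, Set.mem_ofPred_eq, hins, Finset.forall_mem_insert]
  exact and_comm

theorem one_div_sub_one_div_succ {k : ℝ} (hk : 0 < k) : 1 / k - 1 / (k + 1) = 1 / (k * (k + 1)) := by
  field_simp
  ring

/-- Subtracting 1/(h + 1) maps the digit interval (1/(h + 1), 1/h] to (0, 1/(h(h + 1))].
Admissibility nests these intervals, so the last condition implies all the earlier ones. -/
theorem mem_historyEvent_sylvesterDigit_iff {n : ℕ} (hn : 1 ≤ n) {h : ℕ → ℕ}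
    (hh : SylvesterAdmissible n h) (x : ℝ) :
    x ∈ historyEvent (fun n x => sylvesterDigit n x - 1) n h ↔
      x - ∑ j ∈ Finset.Icc 1 n, 1 / ((h j : ℝ) + 1) ∈ Set.Ioc 0 (1 / ((h n : ℝ) * (h n + 1))) := by
  have hshift : ∀ {k : ℕ} (r : ℝ), 1 ≤ k → (r ∈ Set.Ioc (1 / ((k : ℝ) + 1)) (1 / k) ↔
      r - 1 / ((k : ℝ) + 1) ∈ Set.Ioc 0 (1 / ((k : ℝ) * (k + 1)))) := by
    intro k r hk
    rw [← one_div_sub_one_div_succ (by exact_mod_cast hk : (0 : ℝ) < k), Set.mem_Ioc, Set.mem_Ioc,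
      sub_pos, sub_le_sub_iff_right]
  induction n, hn using Nat.le_induction with
  | base =>
    have h1 := hh.1
    rw [Finset.Icc_self, Finset.sum_singleton, ← hshift x h1, ← floor_one_div_eq_iff h1]
    simp [historyEvent, sylvesterDigit, sylvesterRemainder]
  | succ n hn ih =>
    have hpos := (hh.growth hn n.le_succ).1
    have hpos' := (hh.growth (Nat.le_add_left 1 n) le_rfl).1
    have ih := ih (hh.mono n.le_succ)
    rw [mem_historyEvent_succ, Finset.sum_Icc_succ_top (by omega), ← sub_sub, ← hshift _ hpos']
    constructor
    · rintro ⟨h1, h2⟩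
      rw [sylvesterDigit_succ_sub_one, sylvesterRemainder_of_mem_historyEvent h1] at h2
      exact (floor_one_div_eq_iff hpos' _).1 h2
    · intro h2
      have hle : (1 : ℝ) / h (n + 1) ≤ 1 / ((h n : ℝ) * (h n + 1)) := by
        have h3 := hh.2 (n + 1) (Finset.mem_Icc.2 ⟨by omega, le_rfl⟩)
        rw [Nat.add_sub_cancel] at h3
        exact one_div_le_one_div_of_le (by positivity) (by exact_mod_cast h3)
      have h1 := ih.2 ⟨lt_trans (by positivity) h2.1, h2.2.trans hle⟩
      refine ⟨h1, ?_⟩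
      rw [sylvesterDigit_succ_sub_one, sylvesterRemainder_of_mem_historyEvent h1]
      exact (floor_one_div_eq_iff hpos' _).2 h2

theorem historyEvent_sylvesterDigit_subset {n : ℕ} (hn : 1 ≤ n) {h : ℕ → ℕ} (hh : 1 ≤ h 1) :
    historyEvent (fun n x => sylvesterDigit n x - 1) n h ⊆ Set.Icc 0 1 := by
  intro x hx
  have h1 : sylvesterDigit (0 + 1) x - 1 = h 1 := hx 1 (Finset.mem_Icc.2 ⟨le_rfl, hn⟩)
  rw [sylvesterDigit_succ_sub_one, floor_one_div_eq_iff hh] at h1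
  refine ⟨(lt_trans (by positivity) h1.1).le, h1.2.trans ?_⟩
  rw [div_le_one (by exact_mod_cast hh)]
  exact_mod_cast hh

theorem setOf_sub_mem_Ioc (s u v : ℝ) : {x : ℝ | x - s ∈ Set.Ioc u v} = Set.Ioc (s + u) (s + v) := by
  ext x
  simp only [Set.mem_ofPred_eq, Set.mem_Ioc]
  constructor <;> rintro ⟨h1, h2⟩ <;> constructor <;> linarith

/-- A ratio of lengths: the cylinder has length 1/y, and the next digit interval is disjoint from it
(k < y) or lies inside it (k ≥ y). The minima with 1 encode both cases. -/
theorem cond_sylvesterDigit {n : ℕ} (hn : 1 ≤ n) {h : ℕ → ℕ} (hh : SylvesterAdmissible n h) {k : ℕ}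
    (hk : 1 ≤ k) :
    ((volume.restrict (Set.Icc (0 : ℝ) 1))[|historyEvent (fun n x => sylvesterDigit n x - 1) n h]).real
        {x | sylvesterDigit (n + 1) x - 1 = k} =
      min ((h n : ℝ) * (h n + 1) / k) 1 - min ((h n : ℝ) * (h n + 1) / (k + 1)) 1 := by
  set Θ : ℕ → ℝ → ℕ := fun n x => sylvesterDigit n x - 1
  have hΘ : ∀ n, 1 ≤ n → Measurable (Θ n) := fun n _ =>
    (Measurable.of_discrete (f := fun m : ℕ => m - 1)).comp (measurable_sylvesterDigit n)
  set A := historyEvent Θ n h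
  set s := ∑ j ∈ Finset.Icc 1 n, 1 / ((h j : ℝ) + 1)
  have hpos : (1 : ℝ) ≤ h n := by exact_mod_cast (hh.growth hn le_rfl).1
  have hk0 : (1 : ℝ) ≤ k := by exact_mod_cast hk
  set y : ℝ := (h n : ℝ) * (h n + 1) with hy
  have hy0 : 0 < y := by positivity
  have hA : A = Set.Ioc (s + 0) (s + 1 / y) := by
    rw [← setOf_sub_mem_Ioc]
    ext x
    exact mem_historyEvent_sylvesterDigit_iff hn hh x
  have hAsub : A ⊆ Set.Icc 0 1 := historyEvent_sylvesterDigit_subset hn hh.1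
  have hAB : A ∩ {x | Θ (n + 1) x = k} =
      A ∩ Set.Ioc (s + 1 / ((k : ℝ) + 1)) (s + 1 / k) := by
    rw [← setOf_sub_mem_Ioc]
    ext x
    refine and_congr_right fun hx => ?_
    rw [Set.mem_ofPred_eq, Set.mem_ofPred_eq, ← floor_one_div_eq_iff hk,
      ← sylvesterRemainder_of_mem_historyEvent hx]
    simp only [Θ, sylvesterDigit_succ_sub_one]
  rw [measureReal_def, cond_apply (measurableSet_historyEvent hΘ n h), hAB,
    Measure.restrict_eq_self _ hAsub,
    Measure.restrict_eq_self _ (Set.inter_subset_left.trans hAsub), ENNReal.toReal_mul,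
    ENNReal.toReal_inv, ← measureReal_def, ← measureReal_def]
  have hvA : volume.real A = 1 / y := by
    rw [hA, Real.volume_real_Ioc_of_le (by simp only [add_le_add_iff_left]; positivity)]; ring
  rw [hvA, hA, Set.Ioc_inter_Ioc, add_zero,
    max_eq_right (by simp only [le_add_iff_nonneg_right]; positivity), min_add_add_left]
  have hyN : y = (h n * (h n + 1) : ℕ) := by rw [hy]; push_cast; ring
  rcases Nat.lt_or_ge k (h n * (h n + 1)) with hlt | hge
  · have h1 : (k : ℝ) + 1 ≤ y := by rw [hyN]; exact_mod_cast hlt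
    have h2 : (1 : ℝ) / y ≤ 1 / (k + 1) := one_div_le_one_div_of_le (by positivity) h1
    have h3 : (1 : ℝ) / y ≤ 1 / k := one_div_le_one_div_of_le (by positivity) (by linarith)
    rw [min_eq_left h3, Set.Ioc_eq_empty (by simpa using h2), measureReal_empty, mul_zero,
      min_eq_right ((one_le_div (by positivity)).2 (by linarith)),
      min_eq_right ((one_le_div (by positivity)).2 h1), sub_self]
  · have h1 : y ≤ k := by rw [hyN]; exact_mod_cast hge
    have h3 : (1 : ℝ) / k ≤ 1 / y := one_div_le_one_div_of_le hy0 h1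
    have h4 : (1 : ℝ) / (k + 1) ≤ 1 / k := one_div_le_one_div_of_le (by positivity) (by linarith)
    rw [min_eq_right h3, Real.volume_real_Ioc_of_le (by linarith),
      min_eq_left ((div_le_one (by positivity)).2 h1),
      min_eq_left ((div_le_one (by positivity)).2 (by linarith))]
    field_simp
    ring

theorem isSylvesterSequence_sylvesterDigit :
    IsSylvesterSequence (volume.restrict (Set.Icc (0 : ℝ) 1))
      (fun _ t => cdf (volume.restrict (Set.Icc (0 : ℝ) 1)) t) sylvesterDigit where
  measurable n _ := measurable_sylvesterDigit n
  scheme :=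
    { measurable := fun n _ =>
        (Measurable.of_discrete (f := fun m : ℕ => m - 1)).comp (measurable_sylvesterDigit n)
      first_pos := by
        -- The point 0 is discarded: there 1/0 = 0 would make the first digit 1.
        filter_upwards [ae_restrict_mem measurableSet_Icc,
          ae_restrict_of_ae (Measure.ae_ne volume (0 : ℝ))] with x hx hx0
        have hpos : 0 < x := lt_of_le_of_ne hx.1 (Ne.symm hx0)
        rw [sylvesterDigit_succ_sub_one 0]
        exact Nat.le_floor (by simpa [sylvesterRemainder] using (one_le_inv₀ hpos).2 hx.2)
      phi_pos := fun n h _ hh => by positivity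
      q_nonneg := fun _ _ => le_rfl
      cond_law := by
        intro n h hn h1 hadm hlast _
        have hh : SylvesterAdmissible n h := ⟨h1, fun j hj => by exact_mod_cast hadm j hj⟩
        refine (cond_sylvesterDigit hn hh hlast).trans ?_
        have : (0 : ℝ) ≤ (h n : ℝ) * (h n + 1) := by positivity
        simp only [oppenheimDelta, add_zero, mul_one, mul_zero]
        rw [cdf_volume_restrict_Icc (by positivity), cdf_volume_restrict_Icc (by positivity)] }

theorem mainTheorem10 (a : ℕ → ℕ → ℝ) (ρ : ℕ → ℝ) (ℓ : ℝ) :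
    (∀ (Ω : Type*) [MeasurableSpace Ω] (P : Measure Ω) [IsProbabilityMeasure P]
        (ν : ℕ → Measure ℝ) [∀ n, IsProbabilityMeasure (ν n)] (α : ℕ → ℝ) (D : ℕ → Ω → ℕ),
        (∀ n, 1 ≤ n → cdf (ν n) 0 = 0 ∧ cdf (ν n) 1 = 1) →
        RegularAtZero (fun n t => cdf (ν n) t) α →
        WeightConditions α a ρ ℓ →
        IsSylvesterSequence P (fun n t => cdf (ν n) t) D →
        TendstoInMeasure P
          (fun (n : ℕ) (ω : Ω) => 1 / (ρ n * Real.log n) *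
            ∑ k ∈ Finset.Icc 1 n, a k n * ((D (k + 1) ω : ℝ) / (D k ω : ℝ) ^ 2))
          atTop (fun _ => ℓ)) ∧
    (WeightConditions (fun _ => 1) a ρ ℓ →
        TendstoInMeasure (volume.restrict (Set.Icc (0 : ℝ) 1))
          (fun (n : ℕ) (x : ℝ) => 1 / (ρ n * Real.log n) *
            ∑ k ∈ Finset.Icc 1 n,
              a k n * ((sylvesterDigit (k + 1) x : ℝ) / (sylvesterDigit k x : ℝ) ^ 2))
          atTop (fun _ => ℓ)) := by
  refine ⟨fun Ω _ P _ ν _ α D hν hreg hw hD => hD.tendstoInMeasure (fun n hn => (hν n hn).2) hreg hw,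
    fun hw => ?_⟩
  refine isSylvesterSequence_sylvesterDigit.tendstoInMeasure
    (ν := fun _ => volume.restrict (Set.Icc (0 : ℝ) 1)) (fun n _ => ?_)
    regularAtZero_cdf_volume_restrict_Icc hw
  rw [cdf_volume_restrict_Icc zero_le_one, min_self]
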